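/- **Setting.** Let $(\mathcal N,\mathcal E)$, $\mathcal N=\{1,\dots,n\}$, $\mathcal E\subseteq\mathcal N\times\mathcal N$, be a directed graph without loops that is connected when orientations are disregarded. We are given susceptances $B_{ij}$ and line limits $\underline P_{ij},\overline P_{ij}$ for $ij\in\mathcal E$, and damping coefficients $D_i>0$, injections $P_i^{in}$ and load limits $\underline d_i,\overline d_i$ for $i\in\mathcal N$. Put $\Omega=\prod_i[\underline d_i,\overline d_i]$. The cost at bus $i$ is $f_i=f_{i,0}+f_{i,1}+f_{i,2}$, where $f_{i,0}:\mathbb R\to\mathbb R$ is differentiable and $\beta$-strongly convex with $\beta>1$ for all $i$, $f_{i,1}$ is the indicator function ($0$ or $+\infty$) of $[\underline d_i,\overline d_i]$, and $f_{i,2}:\mathbb R\to\mathbb R$ is convex. Write $\theta_{ij}=\theta_i-\theta_j$. Assume Slater's condition: there are $\tilde d\in\mathrm{relint}(\Omega)$ and $\tilde\theta\in\mathbb R^n$ with $0=P^{in}_i-\tilde d_i+\sum_{k:ki\in\mathcal E}B_{ki}\tilde\theta_{ki}-\sum_{j:ij\in\mathcal E}B_{ij}\tilde\theta_{ij}$ for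 all $i$ and $\underline P_{ij}<B_{ij}\tilde\theta_{ij}<\overline P_{ij}$ for all $ij\in\mathcal E$. The reformulated optimal load control problem (ROLC) is to minimize $\sum_i\big(f_i(d_i)+\frac{D_i}{2}\omega_i^2\big)$ over $(d,\hat\theta,\omega,P)$ subject to $0=P_i^{in}-D_i\omega_i-d_i+\sum_{k:ki\in\mathcal E}P_{ki}-\sum_{j:ij\in\mathcal E}P_{ij}$ and $0=P_i^{in}-d_i+\sum_{k:ki\in\mathcal E}B_{ki}\hat\theta_{ki}-\sum_{j:ij\in\mathcal E}B_{ij}\hat\theta_{ij}$ for all $i$, and $\underline P_{ij}\le B_{ij}\hat\theta_{ij}\le\overline P_{ij}$ for all $ij\in\mathcal E$. **Dynamics.** Let $\kappa\in(0,1)$, $u_{i,1}=P_i^{in}-d_i-D_i\omega_i+\sum_{k:ki\in\mathcal E}P_{ki}-\sum_{j:ij\in\mathcal E}P_{ij}$, $u_{i,2}=P_i^{in}-d_i+\sum_{k:ki\in\mathcal E}B_{ki}\hat\theta_{ki}-\sum_{j:ij\in\mathcal E}B_{ij}\hat\theta_{ij}$, $\pi^-_{ij}=\max(\nu^-_{ij}+\underline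 P_{ij}-B_{ij}\hat\theta_{ij},0)$, $\pi^+_{ij}=\max(\nu^+_{ij}+B_{ij}\hat\theta_{ij}-\overline P_{ij},0)$, and $\mathrm{prox}_f(y)=\arg\min_x\{f(x)+\frac12|x-y|^2\}$. The distributed proximal primal-dual (DPPD) dynamics with line thermal limits is $$\begin{aligned} \dot\eta_i&=\mathrm{prox}_{f_{i,2}}(d_i-\kappa\eta_i)-d_i,\\ \dot d_i&=\mathrm{prox}_{f_{i,1}}\big(d_i-f_{i,0}'(d_i)+\kappa\eta_i+\omega_i+u_{i,1}+\mu_i+u_{i,2}\big)-d_i,\\ \dot{\hat\theta}_i&=\sum_{j:ij\in\mathcal E}B_{ij}(\pi^-_{ij}-\pi^+_{ij})+\sum_{k:ki\in\mathcal E}B_{ki}(\pi^+_{ki}-\pi^-_{ki})\\ &\quad+\sum_{j:ij\in\mathcal E}B_{ij}(\mu_i+u_{i,2}-\mu_j-u_{j,2})-\sum_{k:ki\in\mathcal E}B_{ki}(\mu_k+u_{k,2}-\mu_i-u_{i,2}),\\ \dot P_{ij}&=\omega_i+u_{i,1}-\omega_j-u_{j,1},\qquad \dot\omega_i=\tfrac12u_{i,1},\qquad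 \dot\mu_i=\tfrac12u_{i,2},\\ \dot\nu^-_{ij}&=\tfrac12(\pi^-_{ij}-\nu^-_{ij}),\qquad \dot\nu^+_{ij}=\tfrac12(\pi^+_{ij}-\nu^+_{ij}). \end{aligned}$$ **Statement.** Let $(\eta,d,\hat\theta,P,\omega,\mu,\nu^-,\nu^+)$ be any trajectory of DPPD on $[0,\infty)$, with arbitrary initial state. Then: 1. As $t\to\infty$ the trajectory converges to an equilibrium point $(\eta^*,d^*,\hat\theta^*,P^*,\omega^*,\mu^*,\nu^{-*},\nu^{+*})$ of DPPD, and $(d^*,\hat\theta^*,\omega^*,P^*)$ is an optimal solution of ROLC. 2. $\liminf\big(\|\dot d\|+\|\dot\eta\|+\|\dot{\hat\theta}\|+\|\dot P\|+\|\dot\omega\|+\|\dot\mu\|+\|\dot\nu^-\|+\|\dot\nu^+\|\big)=O(1/\sqrt t)$, meaning: there is a constant $c>0$ such that the sum of norms at time $t$ is at most $c/\sqrt t$ for arbitrarily large $t$. -/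

import Mathlib

open Filter Topology

noncomputable section

/-- The proximal operator `prox_{τ f}(y) = argmin_x { f x + |x - y|² / (2 τ) }` of an
extended-real-valued function on the line. -/
def prox (τ : ℝ) (f : ℝ → EReal) (y : ℝ) : ℝ :=
  Classical.epsilon fun x : ℝ =>
    ∀ x' : ℝ, f x + ((1 / (2 * τ) * (x - y) ^ 2 : ℝ) : EReal)
      ≤ f x' + ((1 / (2 * τ) * (x' - y) ^ 2 : ℝ) : EReal)

/-- The projection `P_{ℝ₊}` of the real line onto the half-line of nonnegative numbers. -/
def projNonneg (y : ℝ) : ℝ := max y 0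

/-- `f` is differentiable and `β`-strongly convex (gradient inequality). -/
def IsStronglyConvex (β : ℝ) (f : ℝ → ℝ) : Prop :=
  Differentiable ℝ f ∧
    ∀ x y : ℝ, f x ≥ f y + deriv f y * (x - y) + β / 2 * (x - y) ^ 2

/-- Data of the nonsmooth optimal load control problem on a directed graph with buses `Fin n`:
lines, susceptances, damping coefficients, power injections, load limits, line thermal limits,
and the smooth part `f0` and the nonsmooth part `f2` of the regulation costs. -/
structure LoadControl (n : ℕ) where
  edges : Finset (Fin n × Fin n)
  B : edges → ℝ
  D : Fin n → ℝ
  Pin : Fin n → ℝ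
  dLower : Fin n → ℝ
  dUpper : Fin n → ℝ
  PLower : edges → ℝ
  PUpper : edges → ℝ
  f0 : Fin n → ℝ → ℝ
  f2 : Fin n → ℝ → ℝ

namespace LoadControl

variable {n : ℕ} (N : LoadControl n)

/-- Vectors indexed by the buses, with the Euclidean norm. -/
abbrev BusVec (_N : LoadControl n) : Type := EuclideanSpace ℝ (Fin n)

/-- Vectors indexed by the lines, with the Euclidean norm. -/
abbrev LineVec (N : LoadControl n) : Type := EuclideanSpace ℝ N.edges

/-- No line joins a bus to itself, and the graph is connected (orientation disregarded). -/
def IsConnectedNetwork : Prop :=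
  (∀ i : Fin n, (i, i) ∉ N.edges) ∧
    (SimpleGraph.fromRel fun i j : Fin n => (i, j) ∈ N.edges).Connected

/-- `∑_{j : ij ∈ E} x_{ij}`. -/
def outSum (x : N.edges → ℝ) (i : Fin n) : ℝ :=
  ∑ e : N.edges, if e.1.1 = i then x e else 0

/-- `∑_{k : ki ∈ E} x_{ki}`. -/
def inSum (x : N.edges → ℝ) (i : Fin n) : ℝ :=
  ∑ e : N.edges, if e.1.2 = i then x e else 0

/-- `B_{ij} (θ_i - θ_j)` on the line `e = ij`. -/
def lineFlow (θ : Fin n → ℝ) (e : N.edges) : ℝ :=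
  N.B e * (θ e.1.1 - θ e.1.2)

/-- The box `Ω` of admissible loads. -/
def Omega : Set N.BusVec :=
  {d | ∀ i, N.dLower i ≤ d i ∧ d i ≤ N.dUpper i}

open Classical in
/-- The indicator function `f_{i,1}` of the interval of admissible loads at bus `i`. -/
def f1 (i : Fin n) (x : ℝ) : EReal :=
  if N.dLower i ≤ x ∧ x ≤ N.dUpper i then 0 else ⊤

/-- Slater's condition. -/
def Slater : Prop :=
  ∃ d ∈ intrinsicInterior ℝ N.Omega, ∃ θ : N.BusVec,
    (∀ i, 0 = N.Pin i - d i + N.inSum (N.lineFlow fun j => θ j) i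
      - N.outSum (N.lineFlow fun j => θ j) i) ∧
    ∀ e, N.PLower e < N.lineFlow (fun j => θ j) e ∧ N.lineFlow (fun j => θ j) e < N.PUpper e

/-- The state `(η, d, θ̂, P, ω, μ, ν⁻, ν⁺)` of the algorithm. The multiplier `λ` does not occur,
since the algorithm sets `ω = λ`. -/
structure State (N : LoadControl n) where
  η : N.BusVec
  d : N.BusVec
  θ : N.BusVec
  P : N.LineVec
  ω : N.BusVec
  μ : N.BusVec
  νm : N.LineVec
  νp : N.LineVec

variable {N}

/-- `u_{i,1}`. -/
def State.u1 (z : N.State) (i : Fin n) : ℝ :=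
  N.Pin i - z.d i - N.D i * z.ω i + N.inSum (fun e => z.P e) i - N.outSum (fun e => z.P e) i

/-- `u_{i,2}`. -/
def State.u2 (z : N.State) (i : Fin n) : ℝ :=
  N.Pin i - z.d i + N.inSum (N.lineFlow fun j => z.θ j) i
    - N.outSum (N.lineFlow fun j => z.θ j) i

/-- `P_{ℝ₊}(ν⁻_{ij} + P̲_{ij} - B_{ij} θ̂_{ij})`. -/
def State.projνm (z : N.State) (e : N.edges) : ℝ :=
  projNonneg (z.νm e + N.PLower e - N.lineFlow (fun j => z.θ j) e)

/-- `P_{ℝ₊}(ν⁺_{ij} + B_{ij} θ̂_{ij} - P̅_{ij})`. -/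
def State.projνp (z : N.State) (e : N.edges) : ℝ :=
  projNonneg (z.νp e + N.lineFlow (fun j => z.θ j) e - N.PUpper e)

variable (N)

/-- The right-hand side of the DPPD dynamics, with stepsizes `1` for `η, d, θ̂, P` and `1/2` for
`ω = λ`, `μ`, `ν⁻`, `ν⁺`. -/
def field (κ : ℝ) (z : N.State) : N.State where
  η := WithLp.toLp 2 fun i =>
    prox 1 (fun x => ((N.f2 i x : ℝ) : EReal)) (z.d i - κ * z.η i) - z.d i
  d := WithLp.toLp 2 fun i =>
    prox 1 (N.f1 i)
      (z.d i - deriv (N.f0 i) (z.d i) + κ * z.η i + z.ω i + z.u1 i + z.μ i + z.u2 i) - z.d i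
  θ := WithLp.toLp 2 fun i =>
    N.outSum (fun e => N.B e * (z.projνm e - z.projνp e)) i
      + N.inSum (fun e => N.B e * (z.projνp e - z.projνm e)) i
      + N.outSum (N.lineFlow fun j => z.μ j + z.u2 j) i
      - N.inSum (N.lineFlow fun j => z.μ j + z.u2 j) i
  P := WithLp.toLp 2 fun e =>
    z.ω e.1.1 + z.u1 e.1.1 - z.ω e.1.2 - z.u1 e.1.2
  ω := WithLp.toLp 2 fun i => 1 / 2 * z.u1 i
  μ := WithLp.toLp 2 fun i => 1 / 2 * z.u2 i
  νm := WithLp.toLp 2 fun e => 1 / 2 * (z.projνm e - z.νm e)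
  νp := WithLp.toLp 2 fun e => 1 / 2 * (z.projνp e - z.νp e)

/-- Trajectories of DPPD on `[0, ∞)` (with the one-sided derivative at `0`). The initial state
is arbitrary. -/
def IsTrajectory (κ : ℝ) (z : ℝ → N.State) : Prop :=
  ∀ t : ℝ, 0 ≤ t →
    HasDerivWithinAt (fun s => (z s).η) (N.field κ (z t)).η (Set.Ici 0) t ∧
    HasDerivWithinAt (fun s => (z s).d) (N.field κ (z t)).d (Set.Ici 0) t ∧
    HasDerivWithinAt (fun s => (z s).θ) (N.field κ (z t)).θ (Set.Ici 0) t ∧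
    HasDerivWithinAt (fun s => (z s).P) (N.field κ (z t)).P (Set.Ici 0) t ∧
    HasDerivWithinAt (fun s => (z s).ω) (N.field κ (z t)).ω (Set.Ici 0) t ∧
    HasDerivWithinAt (fun s => (z s).μ) (N.field κ (z t)).μ (Set.Ici 0) t ∧
    HasDerivWithinAt (fun s => (z s).νm) (N.field κ (z t)).νm (Set.Ici 0) t ∧
    HasDerivWithinAt (fun s => (z s).νp) (N.field κ (z t)).νp (Set.Ici 0) t

/-- Equilibrium points of DPPD. -/
def IsEquilibrium (κ : ℝ) (z : N.State) : Prop :=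
  N.field κ z = ⟨0, 0, 0, 0, 0, 0, 0, 0⟩

/-- The trajectory `z` converges to the state `zs`. -/
def ConvergesTo (z : ℝ → N.State) (zs : N.State) : Prop :=
  Tendsto (fun t => (z t).η) atTop (𝓝 zs.η) ∧
  Tendsto (fun t => (z t).d) atTop (𝓝 zs.d) ∧
  Tendsto (fun t => (z t).θ) atTop (𝓝 zs.θ) ∧
  Tendsto (fun t => (z t).P) atTop (𝓝 zs.P) ∧
  Tendsto (fun t => (z t).ω) atTop (𝓝 zs.ω) ∧
  Tendsto (fun t => (z t).μ) atTop (𝓝 zs.μ) ∧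
  Tendsto (fun t => (z t).νm) atTop (𝓝 zs.νm) ∧
  Tendsto (fun t => (z t).νp) atTop (𝓝 zs.νp)

/-- The sum of the Euclidean norms of the time derivatives of all components. -/
def speed (z : ℝ → N.State) (t : ℝ) : ℝ :=
  ‖deriv (fun s => (z s).d) t‖ + ‖deriv (fun s => (z s).η) t‖
    + ‖deriv (fun s => (z s).θ) t‖ + ‖deriv (fun s => (z s).P) t‖
    + ‖deriv (fun s => (z s).ω) t‖ + ‖deriv (fun s => (z s).μ) t‖
    + ‖deriv (fun s => (z s).νm) t‖ + ‖deriv (fun s => (z s).νp) t‖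

/-- The objective `∑ f_i(d_i) + (D_i / 2) ω_i²` with `f_i = f_{i,0} + f_{i,1} + f_{i,2}` of the
reformulated optimal load control problem. -/
def objective (d ω : N.BusVec) : EReal :=
  ∑ i, (((N.f0 i (d i) : ℝ) : EReal) + N.f1 i (d i) + ((N.f2 i (d i) : ℝ) : EReal)
    + ((N.D i / 2 * ω i ^ 2 : ℝ) : EReal))

/-- The constraints of the reformulated problem, line thermal limits included. -/
def IsFeasible (d θ ω : N.BusVec) (P : N.LineVec) : Prop :=
  (∀ i, 0 = N.Pin i - N.D i * ω i - d i + N.inSum (fun e => P e) i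
    - N.outSum (fun e => P e) i) ∧
  (∀ i, 0 = N.Pin i - d i + N.inSum (N.lineFlow fun j => θ j) i
    - N.outSum (N.lineFlow fun j => θ j) i) ∧
  ∀ e, N.PLower e ≤ N.lineFlow (fun j => θ j) e ∧ N.lineFlow (fun j => θ j) e ≤ N.PUpper e

/-- Optimal solutions of the reformulated optimal load control problem. -/
def IsOptimal (d θ ω : N.BusVec) (P : N.LineVec) : Prop :=
  N.IsFeasible d θ ω P ∧
    ∀ (d' θ' ω' : N.BusVec) (P' : N.LineVec),
      N.IsFeasible d' θ' ω' P' → N.objective d ω ≤ N.objective d' ω'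

end LoadControl

end

/-! A state is an equilibrium exactly when it satisfies the optimality conditions `KKT` of ROLC
(`isEquilibrium_iff`); there -κη is a subgradient of the nonsmooth cost, μ is the multiplier of the
power balance in the angles, and ν⁻, ν⁺ are those of the line limits.

Centred at such a point `s`, `lyapunov` adds to a squared distance the Bregman distances of the
smooth costs and of the penalties of an augmented Lagrangian, together with a cross term in η and d.
It dominates κ/8 times the squared distance to `s` (`lyapunov_lower`), and along the flow its
derivative is at most -(1 - (1+κ)²/4) times the squared norm of the field (`lyapunov_dissipation`).
The second bound combines the variational inequalities of the proximal maps and projections, strong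
convexity, and summation by parts on the network, which cancels the coupling between buses and
lines.

If the norm of the field eventually exceeded 1/√t, the Lyapunov function would drop at least like a
multiple of log t; this gives the rate, and also times τ_k → ∞ along which the field tends to zero.
Boundedness yields a cluster point, an equilibrium by continuity. Every equilibrium may serve as
centre, so the function recentred there decreases and vanishes along a subsequence, hence tends to
zero: the whole trajectory converges. The limit is optimal because the `KKT` conditions suffice for
a convex problem (`KKT.isOptimal`).

A centre must exist to begin with (`exists_kkt`). A minimizer of the cost over admissible loads
exists by compactness, Hahn-Banach gives a subgradient that is nonnegative on feasible directions,
and `farkas` turns it into multipliers of the affine constraints. -/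

/-! ### Proximal maps of convex functions and of intervals -/

theorem ConvexOn.exists_subgradient {f : ℝ → ℝ} (hf : ConvexOn ℝ Set.univ f) (x : ℝ) :
    ∃ c : ℝ, ∀ y : ℝ, f x + c * (y - x) ≤ f y := by
  have hx : x ∈ interior (Set.univ : Set ℝ) := by simp
  refine ⟨derivWithin f (Set.Ioi x) x, fun y => ?_⟩
  rcases lt_trichotomy x y with h | rfl | h
  · have := hf.rightDeriv_le_slope_of_mem_interior hx (Set.mem_univ y) h
    rw [slope_def_field, le_div_iff₀ (by linarith)] at this
    linarith
  · simp
  · have := (hf.slope_le_leftDeriv_of_mem_interior (Set.mem_univ y) hx h).trans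
      (hf.leftDeriv_le_rightDeriv_of_mem_interior hx)
    rw [slope_def_field, div_le_iff₀ (by linarith)] at this
    linarith

/-- Moving from the minimizer `p` towards `x` by a fraction t changes the objective by at most t(a +
tb), with a and b as below; if a were negative, a small t would decrease it. -/
theorem variational_of_isMinOn_add_sq {s : Set ℝ} {f : ℝ → ℝ} (hf : ConvexOn ℝ s f) {p y : ℝ}
    (hp : p ∈ s) (hmin : ∀ x ∈ s, f p + 1 / 2 * (p - y) ^ 2 ≤ f x + 1 / 2 * (x - y) ^ 2)
    {x : ℝ} (hx : x ∈ s) : (y - p) * (x - p) ≤ f x - f p := by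
  by_contra! h
  set a := f x - f p + (p - y) * (x - p) with ha
  have ha0 : a < 0 := by rw [ha]; linarith
  set b := 1 / 2 * (x - p) ^ 2 with hb
  have hb0 : 0 ≤ b := by positivity
  have hba : 0 < b - a := by linarith
  -- This t lies in (0, 1] even when b = 0, and makes a + tb equal to -a²/(b - a) < 0.
  set t := -a / (b - a) with ht
  have ht0 : 0 < t := div_pos (by linarith) hba
  have ht1 : t ≤ 1 := by rw [ht, div_le_one hba]; linarith
  have hconv := hf.2 hp hx (sub_nonneg.2 ht1) ht0.le (by ring)
  have hmem := hf.1 hp hx (sub_nonneg.2 ht1) ht0.le (by ring)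
  have hm := hmin _ hmem
  simp only [smul_eq_mul] at hconv hm
  have key : 0 ≤ t * (a + t * b) := by rw [ha, hb]; nlinarith
  have key2 : 0 ≤ a + t * b := nonneg_of_mul_nonneg_right key ht0
  have : a + t * b = -a ^ 2 / (b - a) := by rw [ht]; field_simp; ring
  rw [this] at key2
  have : 0 < a ^ 2 / (b - a) := div_pos (sq_pos_of_neg ha0) hba
  rw [neg_div] at key2
  linarith

theorem exists_isMinOn_add_sq {f : ℝ → ℝ} (hf : ConvexOn ℝ Set.univ f) (y : ℝ) :
    ∃ p : ℝ, ∀ x, f p + 1 / 2 * (p - y) ^ 2 ≤ f x + 1 / 2 * (x - y) ^ 2 := by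
  have hcont : Continuous f := by
    rw [← continuousOn_univ]
    exact hf.continuousOn isOpen_univ
  obtain ⟨c, hc⟩ := hf.exists_subgradient y
  refine Continuous.exists_forall_le (by fun_prop) ?_
  -- Coercivity: a subgradient c at `y` bounds the objective below by f(y) + cw + w²/2 with w = x -
  -- y, and (c + w/2)² ≥ 0 turns this into w²/4 + f(y) - c².
  have h1 : Tendsto (fun x : ℝ => 1 / 4 * ‖x - y‖ ^ 2 + (f y - c ^ 2)) (cocompact ℝ) atTop := by
    refine tendsto_atTop_add_const_right _ _ (Tendsto.const_mul_atTop (by norm_num) ?_)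
    refine (tendsto_pow_atTop two_ne_zero).comp ?_
    exact tendsto_norm_cocompact_atTop.comp
      (Homeomorph.subRight y).isClosedEmbedding.tendsto_cocompact
  refine tendsto_atTop_mono (fun x => ?_) h1
  have := hc x
  rw [Real.norm_eq_abs, sq_abs]
  nlinarith [sq_nonneg (c + 1 / 2 * (x - y))]

theorem prox_coe_isMinOn {f : ℝ → ℝ} (hf : ConvexOn ℝ Set.univ f) (y x : ℝ) :
    f (prox 1 (fun x => ((f x : ℝ) : EReal)) y)
        + 1 / 2 * (prox 1 (fun x => ((f x : ℝ) : EReal)) y - y) ^ 2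
      ≤ f x + 1 / 2 * (x - y) ^ 2 := by
  obtain ⟨p, hp⟩ := exists_isMinOn_add_sq hf y
  have spec : ∀ x' : ℝ, ((f (prox 1 (fun x => ((f x : ℝ) : EReal)) y) : ℝ) : EReal)
        + ((1 / (2 * 1) * (prox 1 (fun x => ((f x : ℝ) : EReal)) y - y) ^ 2 : ℝ) : EReal)
      ≤ ((f x' : ℝ) : EReal) + ((1 / (2 * 1) * (x' - y) ^ 2 : ℝ) : EReal) := by
    -- `prox` is a choice, so its minimality is available only once a minimizer is exhibited.
    refine Classical.epsilon_spec (p := fun x : ℝ =>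
      ∀ x' : ℝ, ((f x : ℝ) : EReal) + ((1 / (2 * 1) * (x - y) ^ 2 : ℝ) : EReal)
        ≤ ((f x' : ℝ) : EReal) + ((1 / (2 * 1) * (x' - y) ^ 2 : ℝ) : EReal)) ⟨p, fun x' => ?_⟩
    rw [← EReal.coe_add, ← EReal.coe_add, EReal.coe_le_coe_iff, mul_one]
    exact hp x'
  have := spec x
  rwa [← EReal.coe_add, ← EReal.coe_add, EReal.coe_le_coe_iff, mul_one] at this

theorem prox_coe_variational {f : ℝ → ℝ} (hf : ConvexOn ℝ Set.univ f) (y x : ℝ) :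
    (y - prox 1 (fun x => ((f x : ℝ) : EReal)) y) * (x - prox 1 (fun x => ((f x : ℝ) : EReal)) y)
      ≤ f x - f (prox 1 (fun x => ((f x : ℝ) : EReal)) y) :=
  variational_of_isMinOn_add_sq hf (Set.mem_univ _) (fun x _ => prox_coe_isMinOn hf y x)
    (Set.mem_univ x)

/-- The variational inequality determines the proximal point: adding those of two candidates gives
(q - p)² ≤ 0. -/
theorem prox_coe_eq_of_subgradient {f : ℝ → ℝ} (hf : ConvexOn ℝ Set.univ f) {y p : ℝ}
    (h : ∀ x, (y - p) * (x - p) ≤ f x - f p) : prox 1 (fun x => ((f x : ℝ) : EReal)) y = p := by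
  have h1 := prox_coe_variational hf y p
  have h2 := h (prox 1 (fun x => ((f x : ℝ) : EReal)) y)
  set q := prox 1 (fun x => ((f x : ℝ) : EReal)) y
  have : (q - p) ^ 2 ≤ 0 := by nlinarith
  have := pow_eq_zero_iff (two_ne_zero) |>.1 (le_antisymm this (sq_nonneg _))
  linarith

theorem continuous_of_firmly_nonexpansive {q : ℝ → ℝ}
    (h : ∀ y y', (q y - q y') ^ 2 ≤ (y - y') * (q y - q y')) : Continuous q := by
  refine (LipschitzWith.of_dist_le_mul (K := 1) fun y y' => ?_).continuous
  rw [NNReal.coe_one, one_mul, Real.dist_eq, Real.dist_eq]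
  refine abs_le_of_sq_le_sq' ?_ (abs_nonneg _) |> abs_le.2
  rw [sq_abs]
  nlinarith [h y y', sq_nonneg ((y - y') - (q y - q y'))]

theorem continuous_prox_coe {f : ℝ → ℝ} (hf : ConvexOn ℝ Set.univ f) :
    Continuous (prox 1 (fun x => ((f x : ℝ) : EReal))) := by
  refine continuous_of_firmly_nonexpansive fun y y' => ?_
  have h1 := prox_coe_variational hf y (prox 1 (fun x => ((f x : ℝ) : EReal)) y')
  have h2 := prox_coe_variational hf y' (prox 1 (fun x => ((f x : ℝ) : EReal)) y)
  nlinarith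

namespace LoadControl
variable {n : ℕ} (N : LoadControl n)

theorem prox_f1_variational {i : Fin n} (hi : N.dLower i ≤ N.dUpper i) (y : ℝ) :
    prox 1 (N.f1 i) y ∈ Set.Icc (N.dLower i) (N.dUpper i) ∧
      ∀ x ∈ Set.Icc (N.dLower i) (N.dUpper i),
        (y - prox 1 (N.f1 i) y) * (x - prox 1 (N.f1 i) y) ≤ 0 := by
  obtain ⟨q, hq, hqmin⟩ := (isCompact_Icc (a := N.dLower i) (b := N.dUpper i)).exists_isMinOn
    (Set.nonempty_Icc.2 hi) (f := fun x => 1 / (2 * 1) * (x - y) ^ 2) (by fun_prop)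
  have hf1 : ∀ x ∈ Set.Icc (N.dLower i) (N.dUpper i), N.f1 i x = 0 := fun x hx => if_pos hx
  have hf1' : ∀ x ∉ Set.Icc (N.dLower i) (N.dUpper i), N.f1 i x = ⊤ := fun x hx => if_neg hx
  have spec : ∀ x' : ℝ, N.f1 i (prox 1 (N.f1 i) y)
        + ((1 / (2 * 1) * (prox 1 (N.f1 i) y - y) ^ 2 : ℝ) : EReal)
      ≤ N.f1 i x' + ((1 / (2 * 1) * (x' - y) ^ 2 : ℝ) : EReal) := by
    refine Classical.epsilon_spec (p := fun x : ℝ =>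
      ∀ x' : ℝ, N.f1 i x + ((1 / (2 * 1) * (x - y) ^ 2 : ℝ) : EReal)
        ≤ N.f1 i x' + ((1 / (2 * 1) * (x' - y) ^ 2 : ℝ) : EReal)) ⟨q, fun x' => ?_⟩
    by_cases hx' : x' ∈ Set.Icc (N.dLower i) (N.dUpper i)
    · rw [hf1 q hq, hf1 x' hx', zero_add, zero_add, EReal.coe_le_coe_iff]
      exact hqmin hx'
    · rw [hf1' x' hx', EReal.top_add_coe]
      exact le_top
  set p := prox 1 (N.f1 i) y
  have hp : p ∈ Set.Icc (N.dLower i) (N.dUpper i) := by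
    by_contra hp
    have := spec q
    rw [hf1' p hp, hf1 q hq, EReal.top_add_coe, zero_add] at this
    exact absurd (top_le_iff.1 this) (EReal.coe_ne_top _)
  refine ⟨hp, fun x hx => ?_⟩
  have := variational_of_isMinOn_add_sq (s := Set.Icc (N.dLower i) (N.dUpper i))
    (f := fun _ => 0) (convexOn_const 0 (convex_Icc _ _)) (p := p) (y := y) hp
    (fun x hx => by
      have := spec x
      rw [hf1 p hp, hf1 x hx, zero_add, zero_add, EReal.coe_le_coe_iff] at this
      simpa using this) hx
  simpa using this

theorem prox_f1_eq {i : Fin n} {y p : ℝ} (hp : p ∈ Set.Icc (N.dLower i) (N.dUpper i))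
    (h : ∀ x ∈ Set.Icc (N.dLower i) (N.dUpper i), (y - p) * (x - p) ≤ 0) :
    prox 1 (N.f1 i) y = p := by
  obtain ⟨hq, hqv⟩ := N.prox_f1_variational (hp.1.trans hp.2) y
  have h1 := hqv p hp
  have h2 := h _ hq
  set q := prox 1 (N.f1 i) y
  have : (q - p) ^ 2 ≤ 0 := by nlinarith
  have := pow_eq_zero_iff (two_ne_zero) |>.1 (le_antisymm this (sq_nonneg _))
  linarith

theorem continuous_prox_f1 {i : Fin n} (hi : N.dLower i ≤ N.dUpper i) :
    Continuous (prox 1 (N.f1 i)) := by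
  refine continuous_of_firmly_nonexpansive fun y y' => ?_
  obtain ⟨h1, h1'⟩ := N.prox_f1_variational hi y
  obtain ⟨h2, h2'⟩ := N.prox_f1_variational hi y'
  nlinarith [h1' _ h2, h2' _ h1]

end LoadControl

/-! ### Strong convexity and continuity of the derivative -/

namespace IsStronglyConvex
variable {β : ℝ} {f : ℝ → ℝ}

theorem deriv_sub_mul_sub (hf : IsStronglyConvex β f) (x y : ℝ) :
    β * (x - y) ^ 2 ≤ (deriv f x - deriv f y) * (x - y) := by
  nlinarith [hf.2 x y, hf.2 y x]

/-- The derivative is monotone, and strong convexity makes it unbounded in both directions. By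
Darboux's theorem it is onto, and a monotone surjection of the line is continuous. -/
theorem continuous_deriv (hf : IsStronglyConvex β f) (hβ : 0 < β) : Continuous (deriv f) := by
  have hmono : Monotone (deriv f) := fun x y hxy => by
    by_contra! h
    nlinarith [hf.deriv_sub_mul_sub x y, mul_nonneg hβ.le (sq_nonneg (x - y)),
      hxy.lt_of_ne (by rintro rfl; exact lt_irrefl _ h)]
  refine hmono.continuous_of_surjective fun c => ?_
  have hoc : Set.OrdConnected (deriv f '' Set.univ) :=
    Set.ordConnected_univ.image_deriv fun x _ => hf.1 x
  -- Over a distance a the derivative changes by at least βa = |c - f'(0)|, so [-a, a] suffices to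
  -- reach c.
  set a := |c - deriv f 0| / β with ha
  have ha0 : 0 ≤ a := by positivity
  have hβa : β * a = |c - deriv f 0| := by rw [ha]; field_simp
  have hle : deriv f (-a) ≤ c := by
    rcases ha0.eq_or_lt with h | h
    · rw [← h, mul_zero] at hβa
      rw [← h, neg_zero]
      linarith [abs_eq_zero.1 hβa.symm]
    · have := hf.deriv_sub_mul_sub (-a) 0
      have h2 : deriv f (-a) - deriv f 0 ≤ -(β * a) := by nlinarith
      linarith [neg_abs_le (c - deriv f 0)]
  have hge : c ≤ deriv f a := by
    rcases ha0.eq_or_lt with h | h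
    · rw [← h, mul_zero] at hβa
      rw [← h]
      linarith [abs_eq_zero.1 hβa.symm]
    · have := hf.deriv_sub_mul_sub a 0
      have h2 : β * a ≤ deriv f a - deriv f 0 := by nlinarith
      linarith [le_abs_self (c - deriv f 0)]
  obtain ⟨x, -, hx⟩ := hoc.out ⟨-a, trivial, rfl⟩ ⟨a, trivial, rfl⟩ ⟨hle, hge⟩
  exact ⟨x, hx⟩

end IsStronglyConvex

/-- **Farkas' lemma**, algebraic form. -/
theorem farkas {ι E : Type*} [AddCommGroup E] [Module ℝ E] (s : Finset ι)
    (a : ι → E →ₗ[ℝ] ℝ) (p : E →ₗ[ℝ] ℝ) (h : ∀ x, (∀ k ∈ s, 0 ≤ a k x) → 0 ≤ p x) :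
    ∃ c : ι → ℝ, (∀ k, 0 ≤ c k) ∧ p = ∑ k ∈ s, c k • a k := by
  classical
  induction s using Finset.induction_on generalizing a p with
  | empty =>
    refine ⟨0, fun _ => le_rfl, ?_⟩
    ext x
    have h1 := h x (by simp)
    have h2 := h (-x) (by simp)
    rw [map_neg] at h2
    simp only [Finset.sum_empty, LinearMap.zero_apply]
    linarith
  | insert b s hb ih =>
    by_cases hs : ∀ x, (∀ k ∈ s, 0 ≤ a k x) → 0 ≤ p x
    · obtain ⟨c, hc, hp⟩ := ih a p hs
      refine ⟨Function.update c b 0, fun k => ?_, ?_⟩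
      · rcases eq_or_ne k b with rfl | hk
        · simp
        · simpa [hk] using hc k
      · rw [Finset.sum_insert hb, hp]
        simp only [Function.update_self, zero_smul, zero_add]
        refine Finset.sum_congr rfl fun k hk => ?_
        rw [Function.update_of_ne (by rintro rfl; exact hb hk)]
    · push Not at hs
      obtain ⟨y₀, hy₀, hpy₀⟩ := hs
      have hby₀ : a b y₀ < 0 := by
        by_contra! hby
        refine absurd (h y₀ fun k hk => ?_) (not_le.2 hpy₀)
        rcases Finset.mem_insert.1 hk with rfl | hk
        · exact hby
        · exact hy₀ k hk
      -- Normalised so that a_b(y) = -1; then x ↦ x + a_b(x) y is a projection onto the kernel of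
      -- a_b.
      set y := (-(a b y₀))⁻¹ • y₀ with hy
      have hpos : 0 < (-(a b y₀))⁻¹ := inv_pos.2 (by linarith)
      have hay : ∀ k ∈ s, 0 ≤ a k y := fun k hk => by
        rw [hy, map_smul, smul_eq_mul]; exact mul_nonneg hpos.le (hy₀ k hk)
      have hpy : p y < 0 := by
        rw [hy, map_smul, smul_eq_mul]; exact mul_neg_of_pos_of_neg hpos hpy₀
      have hby : a b y = -1 := by
        rw [hy, map_smul, smul_eq_mul, inv_neg, neg_mul, inv_mul_cancel₀ hby₀.ne]
      -- The induction hypothesis is applied to the functionals composed with this projection, for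
      -- which the constraint a_b holds with equality.
      obtain ⟨c, hc, hp⟩ := ih (fun k => a k + a k y • a b) (p + p y • a b) (fun x hx => by
        have := h (x + a b x • y) (fun k hk => by
          rcases Finset.mem_insert.1 hk with rfl | hk
          · simp [hby]
          · have := hx k hk
            simp only [LinearMap.add_apply, LinearMap.smul_apply, smul_eq_mul, map_add,
              map_smul] at this ⊢
            linarith)
        simp only [LinearMap.add_apply, LinearMap.smul_apply, smul_eq_mul, map_add,
          map_smul] at this ⊢
        linarith)
      -- The coefficient of a_b collects what the composition added; it is nonnegative since p(y) <
      -- 0 and a_k(y) ≥ 0.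
      refine ⟨Function.update c b (∑ k ∈ s, c k * a k y - p y), fun k => ?_, ?_⟩
      · rcases eq_or_ne k b with rfl | hk
        · rw [Function.update_self]
          have := Finset.sum_nonneg fun k hk => mul_nonneg (hc k) (hay k hk)
          linarith
        · simpa [hk] using hc k
      · have hcongr : ∑ k ∈ s, Function.update c b (∑ k ∈ s, c k * a k y - p y) k • a k
            = ∑ k ∈ s, c k • a k := Finset.sum_congr rfl fun k hk => by
          rw [Function.update_of_ne (by rintro rfl; exact hb hk)]
        rw [Finset.sum_insert hb, Function.update_self, hcongr]
        refine LinearMap.ext fun x => ?_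
        have hx := LinearMap.congr_fun hp x
        simp only [LinearMap.add_apply, LinearMap.sum_apply, LinearMap.smul_apply, smul_eq_mul,
          mul_add, Finset.sum_add_distrib, sub_mul, Finset.sum_mul, mul_assoc] at hx ⊢
        linarith

/-! ### Divergence and line flows on the network; equilibria in coordinates -/

namespace LoadControl
variable {n : ℕ} (N : LoadControl n)

/-- Net outflow `∑_{j : ij ∈ E} x_{ij} - ∑_{k : ki ∈ E} x_{ki}` at bus `i`. -/
def netOut (x : N.edges → ℝ) (i : Fin n) : ℝ := N.outSum x i - N.inSum x i

theorem netOut_add (x y : N.edges → ℝ) (i : Fin n) :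
    N.netOut (fun e => x e + y e) i = N.netOut x i + N.netOut y i := by
  simp only [netOut, outSum, inSum, ← Finset.sum_sub_distrib, ← Finset.sum_add_distrib]
  refine Finset.sum_congr rfl fun e _ => ?_
  split_ifs <;> ring

theorem netOut_smul (c : ℝ) (x : N.edges → ℝ) (i : Fin n) :
    N.netOut (fun e => c * x e) i = c * N.netOut x i := by
  simp only [netOut, outSum, inSum, ← Finset.sum_sub_distrib, Finset.mul_sum]
  refine Finset.sum_congr rfl fun e _ => ?_
  split_ifs <;> ring

theorem netOut_sub (x y : N.edges → ℝ) (i : Fin n) :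
    N.netOut (fun e => x e - y e) i = N.netOut x i - N.netOut y i := by
  simp only [netOut, outSum, inSum, ← Finset.sum_sub_distrib]
  refine Finset.sum_congr rfl fun e _ => ?_
  split_ifs <;> ring

/-- Summation by parts: the divergence is the adjoint of the difference along lines. -/
theorem sum_mul_netOut (x : Fin n → ℝ) (y : N.edges → ℝ) :
    ∑ i, x i * N.netOut y i = ∑ e : N.edges, (x e.1.1 - x e.1.2) * y e := by
  simp only [netOut, outSum, inSum, ← Finset.sum_sub_distrib, Finset.mul_sum]
  rw [Finset.sum_comm]
  refine Finset.sum_congr rfl fun e _ => ?_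
  simp only [mul_sub, mul_ite, mul_zero, Finset.sum_sub_distrib, Finset.sum_ite_eq,
    Finset.mem_univ, if_true]
  ring

theorem sum_mul_netOut_mul (x : Fin n → ℝ) (y : N.edges → ℝ) :
    ∑ i, x i * N.netOut (fun e => N.B e * y e) i = ∑ e : N.edges, N.lineFlow x e * y e := by
  rw [sum_mul_netOut]
  refine Finset.sum_congr rfl fun e _ => ?_
  rw [lineFlow]; ring

/-- Symmetry of the weighted graph Laplacian, valid for susceptances of any sign. -/
theorem sum_mul_netOut_lineFlow_comm (x y : Fin n → ℝ) :
    ∑ i, x i * N.netOut (N.lineFlow y) i = ∑ i, y i * N.netOut (N.lineFlow x) i := by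
  rw [sum_mul_netOut, sum_mul_netOut]
  refine Finset.sum_congr rfl fun e _ => ?_
  rw [lineFlow, lineFlow]; ring

theorem lineFlow_add (x y : Fin n → ℝ) (e : N.edges) :
    N.lineFlow (fun i => x i + y i) e = N.lineFlow x e + N.lineFlow y e := by
  simp only [lineFlow]; ring

theorem lineFlow_sub (x y : Fin n → ℝ) (e : N.edges) :
    N.lineFlow (fun i => x i - y i) e = N.lineFlow x e - N.lineFlow y e := by
  simp only [lineFlow]; ring

theorem lineFlow_smul (c : ℝ) (x : Fin n → ℝ) (e : N.edges) :
    N.lineFlow (fun i => c * x i) e = c * N.lineFlow x e := by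
  simp only [lineFlow]; ring

variable {N} in
theorem State.u1_eq (z : N.State) (i : Fin n) :
    z.u1 i = N.Pin i - z.d i - N.D i * z.ω i - N.netOut (fun e => z.P e) i := by
  rw [State.u1, netOut]; ring

variable {N} in
theorem State.u2_eq (z : N.State) (i : Fin n) :
    z.u2 i = N.Pin i - z.d i - N.netOut (N.lineFlow fun j => z.θ j) i := by
  rw [State.u2, netOut]; ring

/-- Writes the angle dynamics as a pure divergence, the form needed for summation by parts. -/
theorem field_θ_apply (κ : ℝ) (z : N.State) (i : Fin n) :
    (N.field κ z).θ i = N.netOut (fun e => N.B e * (z.projνm e - z.projνp e)) i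
      + N.netOut (N.lineFlow fun j => z.μ j + z.u2 j) i := by
  have h : N.inSum (fun e => N.B e * (z.projνp e - z.projνm e)) i
      = - N.inSum (fun e => N.B e * (z.projνm e - z.projνp e)) i := by
    simp only [inSum, ← Finset.sum_neg_distrib]
    refine Finset.sum_congr rfl fun e _ => ?_
    split_ifs <;> ring
  simp only [field, h, netOut]
  ring

/-- Optimality conditions satisfied by the equilibria, coordinate by coordinate. -/
structure KKT (κ : ℝ) (s : N.State) : Prop where
  u1 : ∀ i, s.u1 i = 0
  u2 : ∀ i, s.u2 i = 0
  ω : ∀ e : N.edges, s.ω e.1.1 = s.ω e.1.2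
  νm : ∀ e, s.projνm e = s.νm e
  νp : ∀ e, s.projνp e = s.νp e
  θ : ∀ i, N.netOut (fun e => N.B e * (s.νm e - s.νp e)) i
      + N.netOut (N.lineFlow fun j => s.μ j) i = 0
  η : ∀ i, prox 1 (fun x => ((N.f2 i x : ℝ) : EReal)) (s.d i - κ * s.η i) = s.d i
  d : ∀ i, prox 1 (N.f1 i) (s.d i - deriv (N.f0 i) (s.d i) + κ * s.η i + s.ω i + s.μ i) = s.d i

theorem State.ext_iff_apply {z w : N.State} :
    z = w ↔ (∀ i, z.η i = w.η i) ∧ (∀ i, z.d i = w.d i) ∧ (∀ i, z.θ i = w.θ i) ∧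
      (∀ i, z.P i = w.P i) ∧ (∀ i, z.ω i = w.ω i) ∧ (∀ i, z.μ i = w.μ i) ∧
      (∀ i, z.νm i = w.νm i) ∧ (∀ i, z.νp i = w.νp i) := by
  constructor
  · rintro rfl; simp
  · rcases z with ⟨⟩; rcases w with ⟨⟩
    rintro ⟨h1, h2, h3, h4, h5, h6, h7, h8⟩
    congr <;> (ext i; simp_all)

theorem isEquilibrium_iff {κ : ℝ} {s : N.State} : N.IsEquilibrium κ s ↔ N.KKT κ s := by
  rw [IsEquilibrium, State.ext_iff_apply]
  simp only [field_θ_apply]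
  simp only [field, PiLp.zero_apply]
  constructor
  · rintro ⟨h1, h2, h3, h4, h5, h6, h7, h8⟩
    have u1 : ∀ i, s.u1 i = 0 := fun i => by linarith [h5 i]
    have u2 : ∀ i, s.u2 i = 0 := fun i => by linarith [h6 i]
    have m : ∀ i, s.projνm i = s.νm i := fun i => by linarith [h7 i]
    have p : ∀ i, s.projνp i = s.νp i := fun i => by linarith [h8 i]
    simp only [u1, u2, m, p, add_zero, sub_eq_zero, sub_zero] at h1 h2 h3 h4
    exact ⟨u1, u2, h4, m, p, h3, h1, h2⟩
  · intro h
    simp only [h.u1, h.u2, h.νm, h.νp, h.η, h.d, h.θ, h.ω, add_zero, sub_self, mul_zero,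
      implies_true, and_self]

theorem dLower_le_dUpper (hS : N.Slater) (i : Fin n) : N.dLower i ≤ N.dUpper i := by
  obtain ⟨d, hd, -⟩ := hS
  have := intrinsicInterior_subset hd i
  exact this.1.trans this.2

/-! ### The Lyapunov function -/

/-- Contribution of a bus to the Lyapunov function. -/
noncomputable def busLyapunov (κ : ℝ) (s z : N.State) (i : Fin n) : ℝ :=
  1 / 2 * (z.d i - s.d i) ^ 2 + κ / 2 * (z.η i - s.η i) ^ 2
    + (N.f0 i (z.d i) - N.f0 i (s.d i) - deriv (N.f0 i) (s.d i) * (z.d i - s.d i))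
    - κ * ((z.η i - s.η i) * (z.d i - s.d i))
    + 1 / 2 * (z.u1 i + (z.ω i - s.ω i)) ^ 2 + 1 / 2 * (z.ω i - s.ω i) ^ 2
    + 3 / 2 * N.D i * (z.ω i - s.ω i) ^ 2 + 1 / 2 * (z.θ i - s.θ i) ^ 2
    + 1 / 2 * (z.u2 i + (z.μ i - s.μ i)) ^ 2 + 1 / 2 * (z.μ i - s.μ i) ^ 2

end LoadControl

/-- Contribution of a multiplier `ν` of a constraint `h ≤ 0` to the Lyapunov function centred at
`(ν₀, h₀)`. -/
noncomputable def multiplierLyapunov (ν₀ h₀ ν h : ℝ) : ℝ :=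
  1 / 2 * (ν - ν₀) ^ 2 + (1 / 2 * projNonneg (ν + h) ^ 2 - 1 / 2 * ν₀ ^ 2
    - ν₀ * (ν - ν₀ + (h - h₀)))

/-- Also at the kink of the projection the function is differentiable: the first-order remainder is
at most |y - x|² everywhere. -/
theorem hasDerivAt_half_projNonneg_sq (x : ℝ) :
    HasDerivAt (fun y => 1 / 2 * projNonneg y ^ 2) (projNonneg x) x := by
  rw [hasDerivAt_iff_isLittleO]
  refine Asymptotics.IsBigO.trans_isLittleO (g := fun y => ‖y - x‖ ^ 2) ?_
    (Asymptotics.isLittleO_pow_sub_sub x one_lt_two)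
  · refine Asymptotics.IsBigO.of_bound 1 (Eventually.of_forall fun y => ?_)
    rw [smul_eq_mul, Real.norm_eq_abs, Real.norm_eq_abs, Real.norm_eq_abs, sq_abs, abs_sq, one_mul]
    simp only [projNonneg]
    rw [abs_le]
    rcases le_total x 0 with hx | hx <;> rcases le_total y 0 with hy | hy <;>
      simp only [max_eq_left hx, max_eq_right hx, max_eq_left hy, max_eq_right hy] <;>
      constructor <;> nlinarith [sq_nonneg (y - x)]

theorem HasDerivWithinAt.multiplierLyapunov {ν h : ℝ → ℝ} {ν' h' t : ℝ} {S : Set ℝ}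
    (hν : HasDerivWithinAt ν ν' S t) (hh : HasDerivWithinAt h h' S t) (ν₀ h₀ : ℝ) :
    HasDerivWithinAt (fun τ => multiplierLyapunov ν₀ h₀ (ν τ) (h τ))
      ((ν t - ν₀) * ν' + (projNonneg (ν t + h t) - ν₀) * (ν' + h')) S t := by
  have h1 : HasDerivWithinAt (fun τ => 1 / 2 * projNonneg (ν τ + h τ) ^ 2)
      (projNonneg (ν t + h t) * (ν' + h')) S t :=
    HasDerivAt.comp_hasDerivWithinAt (h₂ := fun y => 1 / 2 * projNonneg y ^ 2) t
      (hasDerivAt_half_projNonneg_sq (ν t + h t)) (hν.add hh)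
  have := (((hν.sub_const ν₀).pow 2).const_mul (1 / 2)).add
    ((h1.sub_const (1 / 2 * ν₀ ^ 2)).sub
      (((hν.sub_const ν₀).add (hh.sub_const h₀)).const_mul ν₀))
  refine (this.congr_deriv ?_)
  push_cast
  ring

/-- The bracket in `multiplierLyapunov` is a Bregman distance of the convex function max(x, 0)²/2
from ν₀ + h₀ to ν + h, because `h0` says that its slope at ν₀ + h₀ is ν₀. Hence it is nonnegative.
-/
theorem half_sq_le_multiplierLyapunov {ν₀ h₀ : ℝ} (h0 : projNonneg (ν₀ + h₀) = ν₀) (ν h : ℝ) :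
    1 / 2 * (ν - ν₀) ^ 2 ≤ multiplierLyapunov ν₀ h₀ ν h := by
  rw [multiplierLyapunov]
  simp only [projNonneg] at *
  rcases le_total (ν + h) 0 with hx | hx <;> rcases le_total (ν₀ + h₀) 0 with hy | hy <;>
    simp only [max_eq_left hx, max_eq_right hx, max_eq_left hy, max_eq_right hy] at * <;>
    nlinarith [sq_nonneg (ν + h - ν₀)]

/-- With π the projection of ν + h and r = π - ν, the left side equals -r²/2 + (π - ν₀)(π - ν - h) +
(π - ν₀)h₀. The second term is nonpositive by the variational inequality of the projection, the
third by complementary slackness of ν₀ and h₀. -/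
theorem multiplier_dissipation {ν₀ h₀ : ℝ} (h0 : projNonneg (ν₀ + h₀) = ν₀) (ν h : ℝ) :
    (ν - ν₀) * (1 / 2 * (projNonneg (ν + h) - ν))
      + (projNonneg (ν + h) - ν₀) * (1 / 2 * (projNonneg (ν + h) - ν))
      - (projNonneg (ν + h) - ν₀) * (h - h₀) ≤ -(1 / 2) * (projNonneg (ν + h) - ν) ^ 2 := by
  simp only [projNonneg] at *
  rcases le_total (ν + h) 0 with hx | hx <;> rcases le_total (ν₀ + h₀) 0 with hy | hy <;>
    simp only [max_eq_left hx, max_eq_right hx, max_eq_left hy, max_eq_right hy] at * <;>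
    nlinarith

/-! ### Derivative and lower bound of the Lyapunov function -/

namespace LoadControl
variable {n : ℕ} (N : LoadControl n)

/-- The Lyapunov function centred at the equilibrium `s`. -/
noncomputable def lyapunov (κ : ℝ) (s z : N.State) : ℝ :=
  ∑ i, N.busLyapunov κ s z i + ∑ e : N.edges, (1 / 2 * (z.P e - s.P e) ^ 2
    + multiplierLyapunov (s.νm e) (N.PLower e - N.lineFlow (fun j => s.θ j) e)
        (z.νm e) (N.PLower e - N.lineFlow (fun j => z.θ j) e)
    + multiplierLyapunov (s.νp e) (N.lineFlow (fun j => s.θ j) e - N.PUpper e)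
        (z.νp e) (N.lineFlow (fun j => z.θ j) e - N.PUpper e))

variable {N}

/-- Sum of the squared Euclidean norms of the components of a state. -/
noncomputable def State.normSq (z : N.State) : ℝ :=
  ∑ i, (z.η i ^ 2 + z.d i ^ 2 + z.θ i ^ 2 + z.ω i ^ 2 + z.μ i ^ 2)
    + ∑ e, (z.P e ^ 2 + z.νm e ^ 2 + z.νp e ^ 2)

/-- Squared distance of two states. -/
noncomputable def State.distSq (s z : N.State) : ℝ :=
  ∑ i, ((z.η i - s.η i) ^ 2 + (z.d i - s.d i) ^ 2 + (z.θ i - s.θ i) ^ 2 + (z.ω i - s.ω i) ^ 2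
      + (z.μ i - s.μ i) ^ 2)
    + ∑ e, ((z.P e - s.P e) ^ 2 + (z.νm e - s.νm e) ^ 2 + (z.νp e - s.νp e) ^ 2)

variable (N)

/-- Derivative of `busLyapunov` along the vector `w`. -/
noncomputable def busLyapunovDeriv (κ : ℝ) (s z w : N.State) (i : Fin n) : ℝ :=
  (z.d i - s.d i) * w.d i + κ * (z.η i - s.η i) * w.η i
    + (deriv (N.f0 i) (z.d i) - deriv (N.f0 i) (s.d i)) * w.d i
    - κ * (w.η i * (z.d i - s.d i) + (z.η i - s.η i) * w.d i)
    + (z.u1 i + (z.ω i - s.ω i)) * (-w.d i - N.D i * w.ω i - N.netOut (fun e => w.P e) i + w.ω i)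
    + (z.ω i - s.ω i) * w.ω i + 3 * N.D i * (z.ω i - s.ω i) * w.ω i + (z.θ i - s.θ i) * w.θ i
    + (z.u2 i + (z.μ i - s.μ i))
      * (-w.d i - N.netOut (N.lineFlow fun j => w.θ j) i + w.μ i)
    + (z.μ i - s.μ i) * w.μ i

variable {N}

theorem hasDerivWithinAt_apply {ι : Type*} [Fintype ι] {x : ℝ → EuclideanSpace ℝ ι}
    {x' : EuclideanSpace ℝ ι} {S : Set ℝ} {t : ℝ} (h : HasDerivWithinAt x x' S t) (i : ι) :
    HasDerivWithinAt (fun τ => x τ i) (x' i) S t :=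
  (EuclideanSpace.proj (𝕜 := ℝ) i).hasFDerivAt.comp_hasDerivWithinAt t h

theorem hasDerivWithinAt_netOut {y : ℝ → N.edges → ℝ} {y' : N.edges → ℝ} {S : Set ℝ} {t : ℝ}
    (h : ∀ e, HasDerivWithinAt (fun τ => y τ e) (y' e) S t) (i : Fin n) :
    HasDerivWithinAt (fun τ => N.netOut (y τ) i) (N.netOut y' i) S t := by
  simp only [netOut, outSum, inSum]
  refine HasDerivWithinAt.sub (HasDerivWithinAt.fun_sum fun e _ => ?_)
    (HasDerivWithinAt.fun_sum fun e _ => ?_)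
  · split_ifs
    exacts [h e, hasDerivWithinAt_const _ _ _]
  · split_ifs
    exacts [h e, hasDerivWithinAt_const _ _ _]

theorem hasDerivWithinAt_lineFlow {y : ℝ → Fin n → ℝ} {y' : Fin n → ℝ} {S : Set ℝ} {t : ℝ}
    (h : ∀ i, HasDerivWithinAt (fun τ => y τ i) (y' i) S t) (e : N.edges) :
    HasDerivWithinAt (fun τ => N.lineFlow (y τ) e) (N.lineFlow y' e) S t :=
  ((h _).sub (h _)).const_mul _

/-- `z` has derivative `w` at `t` within `S`, coordinate by coordinate. -/
structure HasDerivState (z : ℝ → N.State) (w : N.State) (S : Set ℝ) (t : ℝ) : Prop where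
  η : ∀ i, HasDerivWithinAt (fun τ => (z τ).η i) (w.η i) S t
  d : ∀ i, HasDerivWithinAt (fun τ => (z τ).d i) (w.d i) S t
  θ : ∀ i, HasDerivWithinAt (fun τ => (z τ).θ i) (w.θ i) S t
  P : ∀ i, HasDerivWithinAt (fun τ => (z τ).P i) (w.P i) S t
  ω : ∀ i, HasDerivWithinAt (fun τ => (z τ).ω i) (w.ω i) S t
  μ : ∀ i, HasDerivWithinAt (fun τ => (z τ).μ i) (w.μ i) S t
  νm : ∀ i, HasDerivWithinAt (fun τ => (z τ).νm i) (w.νm i) S t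
  νp : ∀ i, HasDerivWithinAt (fun τ => (z τ).νp i) (w.νp i) S t

theorem IsTrajectory.hasDerivState {κ : ℝ} {z : ℝ → N.State} (hz : N.IsTrajectory κ z) {t : ℝ}
    (ht : 0 ≤ t) : HasDerivState z (N.field κ (z t)) (Set.Ici 0) t := by
  obtain ⟨h1, h2, h3, h4, h5, h6, h7, h8⟩ := hz t ht
  exact ⟨hasDerivWithinAt_apply h1, hasDerivWithinAt_apply h2, hasDerivWithinAt_apply h3,
    hasDerivWithinAt_apply h4, hasDerivWithinAt_apply h5, hasDerivWithinAt_apply h6,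
    hasDerivWithinAt_apply h7, hasDerivWithinAt_apply h8⟩

theorem HasDerivState.busLyapunov {z : ℝ → N.State} {w : N.State} {S : Set ℝ} {t : ℝ}
    (h : HasDerivState z w S t) {i : Fin n} (hf0 : Differentiable ℝ (N.f0 i)) (κ : ℝ)
    (s : N.State) :
    HasDerivWithinAt (fun τ => N.busLyapunov κ s (z τ) i) (N.busLyapunovDeriv κ s (z t) w i) S t := by
  have hd := (h.d i).sub_const (s.d i)
  have hη := (h.η i).sub_const (s.η i)
  have hω := (h.ω i).sub_const (s.ω i)
  have hθ := (h.θ i).sub_const (s.θ i)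
  have hμ := (h.μ i).sub_const (s.μ i)
  have hf : HasDerivWithinAt (fun τ => N.f0 i ((z τ).d i)) (deriv (N.f0 i) ((z t).d i) * w.d i)
      S t := (hf0 ((z t).d i)).hasDerivAt.comp_hasDerivWithinAt t (h.d i)
  have hu1 : HasDerivWithinAt (fun τ => (z τ).u1 i)
      (-w.d i - N.D i * w.ω i - N.netOut (fun e => w.P e) i) S t := by
    simp only [State.u1_eq]
    exact (((h.d i).const_sub _).sub ((h.ω i).const_mul _)).sub (hasDerivWithinAt_netOut h.P i)
  have hu2 : HasDerivWithinAt (fun τ => (z τ).u2 i)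
      (-w.d i - N.netOut (N.lineFlow fun j => w.θ j) i) S t := by
    simp only [State.u2_eq]
    exact ((h.d i).const_sub _).sub (hasDerivWithinAt_netOut (hasDerivWithinAt_lineFlow h.θ) i)
  have := ((((((((((hd.pow 2).const_mul (1 / 2)).add ((hη.pow 2).const_mul (κ / 2))).add
    ((hf.sub_const (N.f0 i (s.d i))).sub (hd.const_mul (deriv (N.f0 i) (s.d i))))).sub
    ((hη.mul hd).const_mul κ)).add
    (((hu1.add hω).pow 2).const_mul (1 / 2))).add
    ((hω.pow 2).const_mul (1 / 2))).add
    ((hω.pow 2).const_mul (3 / 2 * N.D i))).add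
    ((hθ.pow 2).const_mul (1 / 2))).add
    (((hu2.add hμ).pow 2).const_mul (1 / 2))).add
    ((hμ.pow 2).const_mul (1 / 2))
  refine this.congr_deriv ?_
  simp only [busLyapunovDeriv, Pi.add_apply]
  push_cast
  ring

variable (N)

/-- Derivative of `lyapunov` along the vector `w`. -/
noncomputable def lyapunovDeriv (κ : ℝ) (s z w : N.State) : ℝ :=
  ∑ i, N.busLyapunovDeriv κ s z w i + ∑ e : N.edges, ((z.P e - s.P e) * w.P e
    + ((z.νm e - s.νm e) * w.νm e
      + (z.projνm e - s.νm e) * (w.νm e - N.lineFlow (fun j => w.θ j) e))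
    + ((z.νp e - s.νp e) * w.νp e
      + (z.projνp e - s.νp e) * (w.νp e + N.lineFlow (fun j => w.θ j) e)))

variable {N}

theorem HasDerivState.lyapunov {z : ℝ → N.State} {w : N.State} {S : Set ℝ} {t : ℝ}
    (h : HasDerivState z w S t) (hf0 : ∀ i, Differentiable ℝ (N.f0 i)) (κ : ℝ) (s : N.State) :
    HasDerivWithinAt (fun τ => N.lyapunov κ s (z τ)) (N.lyapunovDeriv κ s (z t) w) S t := by
  refine HasDerivWithinAt.add (HasDerivWithinAt.fun_sum fun i _ => h.busLyapunov (hf0 i) κ s)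
    (HasDerivWithinAt.fun_sum fun e _ => ?_)
  have hg := hasDerivWithinAt_lineFlow h.θ e
  have hm := HasDerivWithinAt.multiplierLyapunov (h.νm e) (hg.const_sub (N.PLower e)) (s.νm e)
    (N.PLower e - N.lineFlow (fun j => s.θ j) e)
  have hp := HasDerivWithinAt.multiplierLyapunov (h.νp e) (hg.sub_const (N.PUpper e)) (s.νp e)
    (N.lineFlow (fun j => s.θ j) e - N.PUpper e)
  refine (((((((h.P e).sub_const (s.P e)).pow 2).const_mul (1 / 2)).add hm).add hp)).congr_deriv ?_
  simp only [State.projνm, State.projνp, add_sub_assoc]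
  push_cast
  ring

theorem busLyapunov_lower {κ β : ℝ} (hκ0 : 0 < κ) (hκ1 : κ < 1) (hβ : 1 ≤ β) {i : Fin n}
    (hf0 : IsStronglyConvex β (N.f0 i)) (hD : 0 ≤ N.D i) (s z : N.State) :
    κ / 8 * ((z.η i - s.η i) ^ 2 + (z.d i - s.d i) ^ 2 + (z.θ i - s.θ i) ^ 2
      + (z.ω i - s.ω i) ^ 2 + (z.μ i - s.μ i) ^ 2) ≤ N.busLyapunov κ s z i := by
  have h := hf0.2 (z.d i) (s.d i)
  rw [busLyapunov]
  generalize z.d i - s.d i = a at *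
  generalize z.η i - s.η i = b at *
  generalize z.θ i - s.θ i = x at *
  generalize z.ω i - s.ω i = y at *
  generalize z.μ i - s.μ i = w at *
  have hDy : 0 ≤ N.D i * y ^ 2 := mul_nonneg hD (sq_nonneg y)
  have hβa : 0 ≤ (β - 1) * a ^ 2 := mul_nonneg (by linarith) (sq_nonneg a)
  have hκa : 0 ≤ (1 - κ) * a ^ 2 := mul_nonneg (by linarith) (sq_nonneg a)
  have hκx : 0 ≤ (1 - κ) * x ^ 2 := mul_nonneg (by linarith) (sq_nonneg x)
  have hκy : 0 ≤ (1 - κ) * y ^ 2 := mul_nonneg (by linarith) (sq_nonneg y)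
  have hκw : 0 ≤ (1 - κ) * w ^ 2 := mul_nonneg (by linarith) (sq_nonneg w)
  -- One 24th of this square absorbs the cross term -κab and leaves κb²/8; the a² it costs is
  -- covered by the squared distance and strong convexity.
  have h2 : 0 ≤ κ * (3 * b - 4 * a) ^ 2 := mul_nonneg hκ0.le (sq_nonneg _)
  have h3 : 0 ≤ κ * (b - a) ^ 2 := mul_nonneg hκ0.le (sq_nonneg _)
  nlinarith [sq_nonneg (z.u1 i + y), sq_nonneg (z.u2 i + w), sq_nonneg a, sq_nonneg x,
    sq_nonneg y, sq_nonneg w]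

theorem lyapunov_lower {κ β : ℝ} (hκ0 : 0 < κ) (hκ1 : κ < 1) (hβ : 1 ≤ β)
    (hf0 : ∀ i, IsStronglyConvex β (N.f0 i)) (hD : ∀ i, 0 ≤ N.D i) {s : N.State}
    (hs : N.KKT κ s) (z : N.State) : κ / 8 * s.distSq z ≤ N.lyapunov κ s z := by
  rw [State.distSq, lyapunov, mul_add, Finset.mul_sum, Finset.mul_sum]
  refine add_le_add (Finset.sum_le_sum fun i _ =>
    busLyapunov_lower hκ0 hκ1 hβ (hf0 i) (hD i) s z) (Finset.sum_le_sum fun e _ => ?_)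
  have h1 := half_sq_le_multiplierLyapunov
    (h₀ := N.PLower e - N.lineFlow (fun j => s.θ j) e) (ν₀ := s.νm e)
    (by rw [← add_sub_assoc]; exact hs.νm e) (z.νm e)
    (N.PLower e - N.lineFlow (fun j => z.θ j) e)
  have h2 := half_sq_le_multiplierLyapunov
    (h₀ := N.lineFlow (fun j => s.θ j) e - N.PUpper e) (ν₀ := s.νp e)
    (by rw [← add_sub_assoc]; exact hs.νp e) (z.νp e)
    (N.lineFlow (fun j => z.θ j) e - N.PUpper e)
  nlinarith [sq_nonneg (z.P e - s.P e), sq_nonneg (z.νm e - s.νm e), sq_nonneg (z.νp e - s.νp e)]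

end LoadControl

/-! ### The dissipation inequality -/

/-- In the sum of `h1` and `h2` the products κab cancel. What remains in y and a is -y² - (1+κ)ya -
Fa with Fa ≥ a², and completing the square gives the constant 1 - (1+κ)²/4. The weight 3D/2 on
squared frequencies in `busLyapunov` is the one for which the products Duo cancel; the terms left
after the bound are the couplings to neighbouring buses. -/
theorem bus_dissipation_aux {a b x y F o u m v D κ β p q : ℝ} (hD : 0 ≤ D) (hβ : 1 ≤ β)
    (h1 : 0 ≤ (-x - F + κ * b + o + u + m + v) * (a + x))
    (h2 : 0 ≤ (-y - κ * b) * (a + y)) (h3 : β * a ^ 2 ≤ F * a) :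
    a * x + κ * b * y + F * x - κ * (y * a + b * x)
      + (u + o) * (-x - D * (1 / 2 * u) - p + 1 / 2 * u) + o * (1 / 2 * u)
      + 3 * D * o * (1 / 2 * u) + (v + m) * (-x - q + 1 / 2 * v) + m * (1 / 2 * v)
      ≤ -((1 - (1 + κ) ^ 2 / 4) * (y ^ 2 + x ^ 2 + (1 / 2 * u) ^ 2 + (1 / 2 * v) ^ 2))
        - (u + o) * (-u - a - D * o + p) - (v + m) * (-v - a + q) := by
  have e1 : 0 ≤ ((1 + κ) / 2 * y + a) ^ 2 := sq_nonneg _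
  have e2 : 0 ≤ (β - 1) * a ^ 2 := mul_nonneg (by linarith) (sq_nonneg a)
  have e3 : 0 ≤ (1 + κ) ^ 2 / 4 * (x ^ 2 + (1 / 2 * u) ^ 2 + (1 / 2 * v) ^ 2) := by positivity
  have e4 : 0 ≤ D * o ^ 2 := by positivity
  have e5 : 0 ≤ D * u ^ 2 := by positivity
  linarith [sq_nonneg u, sq_nonneg v]

namespace LoadControl
variable {n : ℕ} {N : LoadControl n}

theorem KKT.u1_eq {κ : ℝ} {s : N.State} (hs : N.KKT κ s) (z : N.State) (i : Fin n) :
    N.netOut (fun e => z.P e - s.P e) i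
      = -z.u1 i - (z.d i - s.d i) - N.D i * (z.ω i - s.ω i) := by
  have := hs.u1 i
  rw [State.u1_eq] at this ⊢
  rw [netOut_sub]
  linarith

theorem KKT.u2_eq {κ : ℝ} {s : N.State} (hs : N.KKT κ s) (z : N.State) (i : Fin n) :
    N.netOut (N.lineFlow fun j => z.θ j - s.θ j) i = -z.u2 i - (z.d i - s.d i) := by
  have := hs.u2 i
  have hl : N.lineFlow (fun j => z.θ j - s.θ j)
      = fun e => N.lineFlow (fun j => z.θ j) e - N.lineFlow (fun j => s.θ j) e :=
    funext fun e => lineFlow_sub _ _ _ _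
  rw [State.u2_eq] at this ⊢
  rw [hl, netOut_sub]
  linarith

theorem bus_dissipation {κ β : ℝ} (hβ : 1 ≤ β)
    {i : Fin n} (hf0 : IsStronglyConvex β (N.f0 i)) (hf2 : ConvexOn ℝ Set.univ (N.f2 i))
    (hD : 0 ≤ N.D i) (hi : N.dLower i ≤ N.dUpper i) {s : N.State} (hs : N.KKT κ s)
    (z : N.State) :
    N.busLyapunovDeriv κ s z (N.field κ z) i ≤
      -((1 - (1 + κ) ^ 2 / 4) * ((N.field κ z).η i ^ 2 + (N.field κ z).d i ^ 2
          + (N.field κ z).ω i ^ 2 + (N.field κ z).μ i ^ 2))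
      - (z.u1 i + (z.ω i - s.ω i)) * (N.netOut (fun e => z.P e - s.P e) i
          + N.netOut (fun e => (N.field κ z).P e) i)
      - (z.u2 i + (z.μ i - s.μ i)) * (N.netOut (N.lineFlow fun j => z.θ j - s.θ j) i
          + N.netOut (N.lineFlow fun j => (N.field κ z).θ j) i)
      + (z.θ i - s.θ i) * (N.field κ z).θ i := by
  have hη : (N.field κ z).η i
      = prox 1 (fun x => ((N.f2 i x : ℝ) : EReal)) (z.d i - κ * z.η i) - z.d i := rfl
  have hd : (N.field κ z).d i = prox 1 (N.f1 i) (z.d i - deriv (N.f0 i) (z.d i) + κ * z.η i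
    + z.ω i + z.u1 i + z.μ i + z.u2 i) - z.d i := rfl
  have hω : (N.field κ z).ω i = 1 / 2 * z.u1 i := rfl
  have hμ : (N.field κ z).μ i = 1 / 2 * z.u2 i := rfl
  -- Each variational inequality at `z` is tested with the point of `s`, and conversely; the sums
  -- are the monotonicity inequalities required above.
  have h2 := prox_coe_variational hf2 (z.d i - κ * z.η i) (s.d i)
  have h2' := prox_coe_variational hf2 (s.d i - κ * s.η i)
    (prox 1 (fun x => ((N.f2 i x : ℝ) : EReal)) (z.d i - κ * z.η i))
  obtain ⟨m1, v1⟩ := N.prox_f1_variational hi (z.d i - deriv (N.f0 i) (z.d i) + κ * z.η i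
    + z.ω i + z.u1 i + z.μ i + z.u2 i)
  obtain ⟨m2, v2⟩ := N.prox_f1_variational hi
    (s.d i - deriv (N.f0 i) (s.d i) + κ * s.η i + s.ω i + s.μ i)
  have v1' := v1 _ m2
  have v2' := v2 _ m1
  rw [hs.d i] at v1' v2'
  rw [hs.η i] at h2'
  have h3 := hf0.deriv_sub_mul_sub (z.d i) (s.d i)
  have key := bus_dissipation_aux (a := z.d i - s.d i) (b := z.η i - s.η i)
    (x := (N.field κ z).d i) (y := (N.field κ z).η i)
    (F := deriv (N.f0 i) (z.d i) - deriv (N.f0 i) (s.d i)) (o := z.ω i - s.ω i) (u := z.u1 i)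
    (m := z.μ i - s.μ i) (v := z.u2 i) (κ := κ) (p := N.netOut (fun e => (N.field κ z).P e) i)
    (q := N.netOut (N.lineFlow fun j => (N.field κ z).θ j) i) hD hβ
    (by rw [hd]; linarith) (by rw [hη]; linarith) h3
  rw [hs.u1_eq, hs.u2_eq, busLyapunovDeriv, hω, hμ]
  linarith

theorem lyapunov_dissipation {κ β : ℝ} (hβ : 1 ≤ β)
    (hf0 : ∀ i, IsStronglyConvex β (N.f0 i)) (hf2 : ∀ i, ConvexOn ℝ Set.univ (N.f2 i))
    (hD : ∀ i, 0 ≤ N.D i) (hd : ∀ i, N.dLower i ≤ N.dUpper i) {s : N.State} (hs : N.KKT κ s)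
    (z : N.State) :
    N.lyapunovDeriv κ s z (N.field κ z) ≤
      -((1 - (1 + κ) ^ 2 / 4) * (N.field κ z).normSq) := by
  set w := N.field κ z with hw
  -- Frequencies of `s` agree at the two ends of a line, so the rate of P is a line difference of
  -- centred quantities, as summation by parts requires.
  have hP : ∀ e, w.P e = (z.u1 e.1.1 + (z.ω e.1.1 - s.ω e.1.1))
      - (z.u1 e.1.2 + (z.ω e.1.2 - s.ω e.1.2)) := fun e => by
    have : w.P e = z.ω e.1.1 + z.u1 e.1.1 - z.ω e.1.2 - z.u1 e.1.2 := rfl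
    rw [this, hs.ω e]; ring
  have hθ : ∀ i, N.netOut (N.lineFlow fun j => z.u2 j + (z.μ j - s.μ j)) i
      = w.θ i - N.netOut (fun e => N.B e
        * ((z.projνm e - s.νm e) - (z.projνp e - s.νp e))) i := fun i => by
    have e1 : (fun e => N.B e * ((z.projνm e - s.νm e) - (z.projνp e - s.νp e)))
        = fun e => N.B e * (z.projνm e - z.projνp e) - N.B e * (s.νm e - s.νp e) := by
      ext e; ring
    have e2 : (N.lineFlow fun j => z.u2 j + (z.μ j - s.μ j))
        = fun e => N.lineFlow (fun j => z.μ j + z.u2 j) e - N.lineFlow (fun j => s.μ j) e := by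
      ext e; simp only [lineFlow]; ring
    rw [e1, e2, netOut_sub, netOut_sub, hw, field_θ_apply]
    linarith [hs.θ i]
  have hbus := Finset.sum_le_sum fun i (_ : i ∈ Finset.univ) =>
    bus_dissipation hβ (hf0 i) (hf2 i) (hD i) (hd i) hs z
  simp only [← hw] at hbus
  have s1 : ∑ i, (z.u1 i + (z.ω i - s.ω i)) * (N.netOut (fun e => z.P e - s.P e) i
      + N.netOut (fun e => w.P e) i) = ∑ e, w.P e * (z.P e - s.P e + w.P e) := by
    simp only [← netOut_add, sum_mul_netOut, ← hP]
  have s2 : ∑ i, (z.u2 i + (z.μ i - s.μ i)) * (N.netOut (N.lineFlow fun j => z.θ j - s.θ j) i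
      + N.netOut (N.lineFlow fun j => w.θ j) i)
      = ∑ i, (z.θ i - s.θ i + w.θ i) * w.θ i
        - ∑ e, N.lineFlow (fun i => z.θ i - s.θ i + w.θ i) e
          * ((z.projνm e - s.νm e) - (z.projνp e - s.νp e)) := by
    have : ∀ i, N.netOut (N.lineFlow fun j => z.θ j - s.θ j) i
        + N.netOut (N.lineFlow fun j => w.θ j) i
        = N.netOut (N.lineFlow fun j => z.θ j - s.θ j + w.θ j) i := fun i => by
      rw [← netOut_add]; congr 1; ext e; rw [lineFlow_add]
    simp only [this]
    rw [sum_mul_netOut_lineFlow_comm, ← sum_mul_netOut_mul, ← Finset.sum_sub_distrib]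
    refine Finset.sum_congr rfl fun i _ => ?_
    rw [hθ]; ring
  -- The squared rates of θ and P appear with coefficient 1, those of ν⁻ and ν⁺ with coefficient 2,
  -- so c ≤ 1 suffices for all of them.
  have hc : 1 - (1 + κ) ^ 2 / 4 ≤ 1 := by linarith [sq_nonneg (1 + κ)]
  set c := 1 - (1 + κ) ^ 2 / 4
  simp only [Finset.sum_add_distrib, Finset.sum_sub_distrib] at hbus
  rw [s1, s2] at hbus
  have hA : ∑ i, -(c * (w.η i ^ 2 + w.d i ^ 2 + w.ω i ^ 2 + w.μ i ^ 2))
      - ∑ i, (z.θ i - s.θ i + w.θ i) * w.θ i + ∑ i, (z.θ i - s.θ i) * w.θ i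
      ≤ ∑ i, -(c * (w.η i ^ 2 + w.d i ^ 2 + w.θ i ^ 2 + w.ω i ^ 2 + w.μ i ^ 2)) := by
    rw [← Finset.sum_sub_distrib, ← Finset.sum_add_distrib]
    refine Finset.sum_le_sum fun i _ => ?_
    nlinarith [sq_nonneg (w.θ i)]
  have hE : ∑ e : N.edges, ((z.P e - s.P e) * w.P e
        + ((z.νm e - s.νm e) * w.νm e
          + (z.projνm e - s.νm e) * (w.νm e - N.lineFlow (fun j => w.θ j) e))
        + ((z.νp e - s.νp e) * w.νp e
          + (z.projνp e - s.νp e) * (w.νp e + N.lineFlow (fun j => w.θ j) e)))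
      - ∑ e, w.P e * (z.P e - s.P e + w.P e)
      + ∑ e, N.lineFlow (fun i => z.θ i - s.θ i + w.θ i) e
          * ((z.projνm e - s.νm e) - (z.projνp e - s.νp e))
      ≤ ∑ e, -(c * (w.P e ^ 2 + w.νm e ^ 2 + w.νp e ^ 2)) := by
    rw [← Finset.sum_sub_distrib, ← Finset.sum_add_distrib]
    refine Finset.sum_le_sum fun e _ => ?_
    have h1 := multiplier_dissipation
      (h₀ := N.PLower e - N.lineFlow (fun j => s.θ j) e) (ν₀ := s.νm e)
      (by rw [← add_sub_assoc]; exact hs.νm e) (z.νm e)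
      (N.PLower e - N.lineFlow (fun j => z.θ j) e)
    have h2 := multiplier_dissipation
      (h₀ := N.lineFlow (fun j => s.θ j) e - N.PUpper e) (ν₀ := s.νp e)
      (by rw [← add_sub_assoc]; exact hs.νp e) (z.νp e)
      (N.lineFlow (fun j => z.θ j) e - N.PUpper e)
    have hm : w.νm e = 1 / 2 * (projNonneg (z.νm e
      + (N.PLower e - N.lineFlow (fun j => z.θ j) e)) - z.νm e) := by
      rw [← add_sub_assoc]; rfl
    have hp : w.νp e = 1 / 2 * (projNonneg (z.νp e
      + (N.lineFlow (fun j => z.θ j) e - N.PUpper e)) - z.νp e) := by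
      rw [← add_sub_assoc]; rfl
    have hm' : z.projνm e = projNonneg (z.νm e
      + (N.PLower e - N.lineFlow (fun j => z.θ j) e)) := by rw [← add_sub_assoc]; rfl
    have hp' : z.projνp e = projNonneg (z.νp e
      + (N.lineFlow (fun j => z.θ j) e - N.PUpper e)) := by rw [← add_sub_assoc]; rfl
    rw [hm', hp', lineFlow_add, lineFlow_sub]
    generalize projNonneg (z.νm e + (N.PLower e - N.lineFlow (fun j => z.θ j) e)) = x at *
    generalize projNonneg (z.νp e + (N.lineFlow (fun j => z.θ j) e - N.PUpper e)) = y at *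
    have hc' : 0 ≤ (1 - c) * (w.P e ^ 2 + w.νm e ^ 2 + w.νp e ^ 2) :=
      mul_nonneg (by linarith) (by positivity)
    rw [hm, hp] at hc' ⊢
    linarith [sq_nonneg (x - z.νm e), sq_nonneg (y - z.νp e)]
  have hN : -(c * w.normSq)
      = ∑ i, -(c * (w.η i ^ 2 + w.d i ^ 2 + w.θ i ^ 2 + w.ω i ^ 2 + w.μ i ^ 2))
        + ∑ e, -(c * (w.P e ^ 2 + w.νm e ^ 2 + w.νp e ^ 2)) := by
    rw [State.normSq, mul_add, Finset.mul_sum, Finset.mul_sum, Finset.sum_neg_distrib,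
      Finset.sum_neg_distrib]
    ring
  rw [hN, lyapunovDeriv]
  linarith

end LoadControl

/-! ### Scalar consequences of dissipation -/

/-- Otherwise V' ≤ -a/t from some time on, so V + a log t would be nonincreasing, which is
impossible for V ≥ 0. Divergence of the logarithm makes the constant 1 work for every a > 0. -/
theorem frequently_le_one_div_sqrt {V V' q : ℝ → ℝ} {a : ℝ} (ha : 0 < a) (hV : ∀ t, 0 ≤ V t)
    (hd : ∀ t, 0 < t → HasDerivAt V (V' t) t) (hV' : ∀ t, 0 < t → V' t ≤ -(a * q t ^ 2)) :
    ∃ᶠ t in atTop, q t ≤ 1 / Real.sqrt t := by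
  intro hne
  obtain ⟨T, hT⟩ := eventually_atTop.1 hne
  set T' := max T 1
  have hlog : ∀ t, 0 < t → HasDerivAt (fun t => V t + a * Real.log t) (V' t + a * t⁻¹) t :=
    fun t ht => (hd t ht).add ((Real.hasDerivAt_log ht.ne').const_mul a)
  have hpos : ∀ t ∈ Set.Ici T', 0 < t := fun t ht =>
    zero_lt_one.trans_le ((le_max_right T 1).trans ht)
  have hanti : AntitoneOn (fun t => V t + a * Real.log t) (Set.Ici T') := by
    refine antitoneOn_of_deriv_nonpos (convex_Ici _)
      (fun t ht => (hlog t (hpos t ht)).continuousAt.continuousWithinAt)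
      (fun t ht => (hlog t (hpos t (interior_subset ht))).differentiableAt.differentiableWithinAt)
      fun t ht => ?_
    have ht0 := hpos t (interior_subset ht)
    rw [(hlog t ht0).deriv]
    have h1 := hV' t ht0
    have h2 : 1 / Real.sqrt t < q t := not_le.1 (hT t ((le_max_left T 1).trans (interior_subset ht)))
    have h3 : t⁻¹ ≤ q t ^ 2 := by
      have : (1 / Real.sqrt t) ^ 2 = t⁻¹ := by
        rw [div_pow, Real.sq_sqrt ht0.le, one_pow, one_div]
      rw [← this]
      exact pow_le_pow_left₀ (by positivity) h2.le 2
    nlinarith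
  obtain ⟨t, ht1, ht2⟩ := ((tendsto_atTop.1 (Real.tendsto_log_atTop.const_mul_atTop ha)
    (V T' + a * Real.log T' + 1)).and (eventually_ge_atTop T')).exists
  have := hanti Set.self_mem_Ici (Set.mem_Ici.2 ht2) ht2
  simp only at this
  linarith [hV t]

theorem tendsto_zero_of_antitoneOn {V : ℝ → ℝ} (hV : ∀ t, 0 ≤ V t)
    (hanti : AntitoneOn V (Set.Ici 0)) {u : ℕ → ℝ} (hu : Tendsto u atTop atTop)
    (hVu : Tendsto (fun k => V (u k)) atTop (𝓝 0)) : Tendsto V atTop (𝓝 0) := by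
  rw [Metric.tendsto_atTop]
  intro ε hε
  obtain ⟨k, hk1, hk2⟩ := ((hVu.eventually (gt_mem_nhds hε)).and
    (hu.eventually (eventually_ge_atTop 0))).exists
  refine ⟨u k, fun t ht => ?_⟩
  rw [Real.dist_eq, sub_zero, abs_of_nonneg (hV t)]
  exact (hanti (Set.mem_Ici.2 hk2) (Set.mem_Ici.2 (hk2.trans ht)) ht).trans_lt hk1

theorem sq_add_eight_le (a b c d e f g h : ℝ) : (a + b + c + d + e + f + g + h) ^ 2
    ≤ 8 * (a ^ 2 + b ^ 2 + c ^ 2 + d ^ 2 + e ^ 2 + f ^ 2 + g ^ 2 + h ^ 2) := by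
  have := sq_sum_le_card_mul_sum_sq (s := Finset.univ) (f := ![a, b, c, d, e, f, g, h])
  rw [Fin.sum_univ_eight, Fin.sum_univ_eight, Finset.card_univ, Fintype.card_fin,
    show ((8 : ℕ) : ℝ) = 8 from by norm_num] at this
  exact this

/-! ### Norms of states and continuity of the field -/

namespace LoadControl
variable {n : ℕ} {N : LoadControl n}

theorem State.normSq_eq (z : N.State) : z.normSq = ‖z.η‖ ^ 2 + ‖z.d‖ ^ 2 + ‖z.θ‖ ^ 2 + ‖z.ω‖ ^ 2
    + ‖z.μ‖ ^ 2 + ‖z.P‖ ^ 2 + ‖z.νm‖ ^ 2 + ‖z.νp‖ ^ 2 := by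
  simp only [State.normSq, EuclideanSpace.real_norm_sq_eq, Finset.sum_add_distrib]
  ring

theorem State.distSq_eq (s z : N.State) : s.distSq z = ‖z.η - s.η‖ ^ 2 + ‖z.d - s.d‖ ^ 2
    + ‖z.θ - s.θ‖ ^ 2 + ‖z.ω - s.ω‖ ^ 2 + ‖z.μ - s.μ‖ ^ 2 + ‖z.P - s.P‖ ^ 2
    + ‖z.νm - s.νm‖ ^ 2 + ‖z.νp - s.νp‖ ^ 2 := by
  simp only [State.distSq, EuclideanSpace.real_norm_sq_eq, Finset.sum_add_distrib, PiLp.sub_apply]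
  ring

theorem convergesTo_of_distSq {z : ℝ → N.State} {s : N.State}
    (h : Tendsto (fun t => s.distSq (z t)) atTop (𝓝 0)) : N.ConvergesTo z s := by
  have key : ∀ {E : Type} [NormedAddCommGroup E] (x : ℝ → E) (x₀ : E),
      (∀ t, ‖x t - x₀‖ ^ 2 ≤ s.distSq (z t)) → Tendsto x atTop (𝓝 x₀) := by
    intro E _ x x₀ hx
    rw [tendsto_iff_norm_sub_tendsto_zero]
    have h0 := squeeze_zero (fun t => sq_nonneg _) hx h
    simpa using h0.sqrt
  refine ⟨key _ _ fun t => ?_, key _ _ fun t => ?_, key _ _ fun t => ?_, key _ _ fun t => ?_,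
    key _ _ fun t => ?_, key _ _ fun t => ?_, key _ _ fun t => ?_, key _ _ fun t => ?_⟩ <;>
  · rw [State.distSq_eq]
    rw [← sub_nonneg]
    ring_nf
    positivity

/-- Coordinatewise convergence of states. -/
structure TendstoState {α : Type*} (u : α → N.State) (l : Filter α) (z : N.State) : Prop where
  η : ∀ i, Tendsto (fun a => (u a).η i) l (𝓝 (z.η i))
  d : ∀ i, Tendsto (fun a => (u a).d i) l (𝓝 (z.d i))
  θ : ∀ i, Tendsto (fun a => (u a).θ i) l (𝓝 (z.θ i))
  P : ∀ i, Tendsto (fun a => (u a).P i) l (𝓝 (z.P i))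
  ω : ∀ i, Tendsto (fun a => (u a).ω i) l (𝓝 (z.ω i))
  μ : ∀ i, Tendsto (fun a => (u a).μ i) l (𝓝 (z.μ i))
  νm : ∀ i, Tendsto (fun a => (u a).νm i) l (𝓝 (z.νm i))
  νp : ∀ i, Tendsto (fun a => (u a).νp i) l (𝓝 (z.νp i))

namespace TendstoState
variable {α : Type*} {u : α → N.State} {l : Filter α} {z : N.State}

theorem _root_.LoadControl.tendsto_netOut {y : α → N.edges → ℝ} {y₀ : N.edges → ℝ}
    (h : ∀ e, Tendsto (fun a => y a e) l (𝓝 (y₀ e))) (i : Fin n) :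
    Tendsto (fun a => N.netOut (y a) i) l (𝓝 (N.netOut y₀ i)) := by
  simp only [netOut, outSum, inSum]
  refine Tendsto.sub (tendsto_finsetSum _ fun e _ => ?_) (tendsto_finsetSum _ fun e _ => ?_)
  · split_ifs
    exacts [h e, tendsto_const_nhds]
  · split_ifs
    exacts [h e, tendsto_const_nhds]

theorem _root_.LoadControl.tendsto_lineFlow {y : α → Fin n → ℝ} {y₀ : Fin n → ℝ}
    (h : ∀ i, Tendsto (fun a => y a i) l (𝓝 (y₀ i))) (e : N.edges) :
    Tendsto (fun a => N.lineFlow (y a) e) l (𝓝 (N.lineFlow y₀ e)) :=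
  ((h _).sub (h _)).const_mul _

theorem u1 (h : TendstoState u l z) (i : Fin n) : Tendsto (fun a => (u a).u1 i) l (𝓝 (z.u1 i)) := by
  simp only [State.u1_eq]
  exact ((tendsto_const_nhds.sub (h.d i)).sub ((h.ω i).const_mul _)).sub (tendsto_netOut h.P i)

theorem u2 (h : TendstoState u l z) (i : Fin n) : Tendsto (fun a => (u a).u2 i) l (𝓝 (z.u2 i)) := by
  simp only [State.u2_eq]
  exact (tendsto_const_nhds.sub (h.d i)).sub (tendsto_netOut (tendsto_lineFlow h.θ) i)

theorem _root_.continuous_projNonneg : Continuous projNonneg := continuous_id.max continuous_const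

theorem projνm (h : TendstoState u l z) (e : N.edges) :
    Tendsto (fun a => (u a).projνm e) l (𝓝 (z.projνm e)) :=
  (continuous_projNonneg.tendsto _).comp
    (show Tendsto (fun a => (u a).νm e + N.PLower e - N.lineFlow (fun j => (u a).θ j) e) l
      (𝓝 (z.νm e + N.PLower e - N.lineFlow (fun j => z.θ j) e)) from
      ((h.νm e).add_const _).sub (tendsto_lineFlow h.θ e))

theorem projνp (h : TendstoState u l z) (e : N.edges) :
    Tendsto (fun a => (u a).projνp e) l (𝓝 (z.projνp e)) :=
  (continuous_projNonneg.tendsto _).comp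
    (show Tendsto (fun a => (u a).νp e + N.lineFlow (fun j => (u a).θ j) e - N.PUpper e) l
      (𝓝 (z.νp e + N.lineFlow (fun j => z.θ j) e - N.PUpper e)) from
      ((h.νp e).add (tendsto_lineFlow h.θ e)).sub_const _)

theorem field {κ : ℝ} (h : TendstoState u l z) (hf2 : ∀ i, ConvexOn ℝ Set.univ (N.f2 i))
    (hf0 : ∀ i, Continuous (deriv (N.f0 i))) (hd : ∀ i, N.dLower i ≤ N.dUpper i) :
    TendstoState (fun a => N.field κ (u a)) l (N.field κ z) where
  η i := by
    have h1 : Tendsto (fun a => (u a).d i - κ * (u a).η i) l (𝓝 (z.d i - κ * z.η i)) :=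
      (h.d i).sub ((h.η i).const_mul κ)
    exact (((continuous_prox_coe (hf2 i)).tendsto _).comp h1).sub (h.d i)
  d i := by
    have h1 : Tendsto (fun a => deriv (N.f0 i) ((u a).d i)) l (𝓝 (deriv (N.f0 i) (z.d i))) :=
      ((hf0 i).tendsto _).comp (h.d i)
    have h2 : Tendsto (fun a => (u a).d i - deriv (N.f0 i) ((u a).d i) + κ * (u a).η i + (u a).ω i
        + (u a).u1 i + (u a).μ i + (u a).u2 i) l (𝓝 (z.d i - deriv (N.f0 i) (z.d i) + κ * z.η i
        + z.ω i + z.u1 i + z.μ i + z.u2 i)) :=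
      ((((((h.d i).sub h1).add ((h.η i).const_mul κ)).add (h.ω i)).add (h.u1 i)).add
        (h.μ i)).add (h.u2 i)
    exact (((N.continuous_prox_f1 (hd i)).tendsto _).comp h2).sub (h.d i)
  θ i := by
    simp only [field_θ_apply]
    exact (tendsto_netOut (fun e => ((h.projνm e).sub (h.projνp e)).const_mul _) i).add
      (tendsto_netOut (tendsto_lineFlow fun j => (h.μ j).add (h.u2 j)) i)
  P e := (((h.ω e.1.1).add (h.u1 e.1.1)).sub (h.ω e.1.2)).sub (h.u1 e.1.2)
  ω i := (h.u1 i).const_mul _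
  μ i := (h.u2 i).const_mul _
  νm e := ((h.projνm e).sub (h.νm e)).const_mul _
  νp e := ((h.projνp e).sub (h.νp e)).const_mul _

theorem normSq (h : TendstoState u l z) : Tendsto (fun a => (u a).normSq) l (𝓝 z.normSq) :=
  Tendsto.add (tendsto_finsetSum _ fun i _ => (((((h.η i).pow 2).add ((h.d i).pow 2)).add
    ((h.θ i).pow 2)).add ((h.ω i).pow 2)).add ((h.μ i).pow 2))
    (tendsto_finsetSum _ fun e _ => (((h.P e).pow 2).add ((h.νm e).pow 2)).add ((h.νp e).pow 2))

theorem lyapunov (h : TendstoState u l z) (hf0 : ∀ i, Continuous (N.f0 i)) (κ : ℝ) (s : N.State) :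
    Tendsto (fun a => N.lyapunov κ s (u a)) l (𝓝 (N.lyapunov κ s z)) := by
  refine Tendsto.add (tendsto_finsetSum _ fun i _ => ?_) (tendsto_finsetSum _ fun e _ => ?_)
  · have hd := (h.d i).sub_const (s.d i)
    have hη := (h.η i).sub_const (s.η i)
    have hω := (h.ω i).sub_const (s.ω i)
    have hθ := (h.θ i).sub_const (s.θ i)
    have hμ := (h.μ i).sub_const (s.μ i)
    have hf := ((hf0 i).tendsto _).comp (h.d i)
    exact ((((((((((hd.pow 2).const_mul (1 / 2)).add ((hη.pow 2).const_mul (κ / 2))).add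
      ((hf.sub_const (N.f0 i (s.d i))).sub (hd.const_mul (deriv (N.f0 i) (s.d i))))).sub
      ((hη.mul hd).const_mul κ)).add
      ((((h.u1 i).add hω).pow 2).const_mul (1 / 2))).add
      ((hω.pow 2).const_mul (1 / 2))).add
      ((hω.pow 2).const_mul (3 / 2 * N.D i))).add
      ((hθ.pow 2).const_mul (1 / 2))).add
      ((((h.u2 i).add hμ).pow 2).const_mul (1 / 2))).add
      ((hμ.pow 2).const_mul (1 / 2))
  · have hg := tendsto_lineFlow h.θ e
    have key : ∀ {x y : α → ℝ} {x₀ y₀ : ℝ} (a b : ℝ), Tendsto x l (𝓝 x₀) → Tendsto y l (𝓝 y₀) →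
        Tendsto (fun t => multiplierLyapunov a b (x t) (y t)) l
          (𝓝 (multiplierLyapunov a b x₀ y₀)) := fun a b hx hy =>
      (((hx.sub_const a).pow 2).const_mul _).add
        ((((((continuous_projNonneg.tendsto _).comp (hx.add hy)).pow 2).const_mul _).sub_const
          _).sub (((hx.sub_const a).add (hy.sub_const b)).const_mul a))
    exact (((((h.P e).sub_const _).pow 2).const_mul _).add
      (key _ _ (h.νm e) (hg.const_sub _))).add (key _ _ (h.νp e) (hg.sub_const _))

end TendstoState

theorem KKT.lyapunov_self {κ : ℝ} {s : N.State} (hs : N.KKT κ s) : N.lyapunov κ s s = 0 := by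
  have hm : ∀ e, projNonneg (s.νm e + (N.PLower e - N.lineFlow (fun j => s.θ j) e)) = s.νm e :=
    fun e => by rw [← add_sub_assoc]; exact hs.νm e
  have hp : ∀ e, projNonneg (s.νp e + (N.lineFlow (fun j => s.θ j) e - N.PUpper e)) = s.νp e :=
    fun e => by rw [← add_sub_assoc]; exact hs.νp e
  simp [lyapunov, busLyapunov, multiplierLyapunov, hs.u1, hs.u2, hm, hp]

theorem eq_zero_of_normSq_eq_zero {z : N.State} (h : z.normSq = 0) : z = ⟨0, 0, 0, 0, 0, 0, 0, 0⟩ := by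
  rw [State.normSq_eq] at h
  have key : ∀ {E : Type} [NormedAddCommGroup E] (x : E), ‖x‖ ^ 2 ≤ 0 → x = 0 := fun x hx => by
    simpa using le_antisymm hx (sq_nonneg _)
  have h1 := sq_nonneg ‖z.η‖
  have h2 := sq_nonneg ‖z.d‖
  have h3 := sq_nonneg ‖z.θ‖
  have h4 := sq_nonneg ‖z.ω‖
  have h5 := sq_nonneg ‖z.μ‖
  have h6 := sq_nonneg ‖z.P‖
  have h7 := sq_nonneg ‖z.νm‖
  have h8 := sq_nonneg ‖z.νp‖
  rcases z with ⟨⟩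
  congr <;> (refine key _ ?_; simp only at *; linarith)

theorem IsTrajectory.speed_sq_le {κ : ℝ} {z : ℝ → N.State} (hz : N.IsTrajectory κ z) {t : ℝ}
    (ht : 0 < t) : N.speed z t ^ 2 ≤ 8 * (N.field κ (z t)).normSq := by
  obtain ⟨h1, h2, h3, h4, h5, h6, h7, h8⟩ := hz t ht.le
  have hn := Ici_mem_nhds ht
  rw [speed, (h1.hasDerivAt hn).deriv, (h2.hasDerivAt hn).deriv, (h3.hasDerivAt hn).deriv,
    (h4.hasDerivAt hn).deriv, (h5.hasDerivAt hn).deriv, (h6.hasDerivAt hn).deriv,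
    (h7.hasDerivAt hn).deriv, (h8.hasDerivAt hn).deriv, State.normSq_eq]
  refine (sq_add_eight_le _ _ _ _ _ _ _ _).trans (le_of_eq ?_)
  ring

end LoadControl

/-! ### Decay along trajectories and convergence -/

namespace LoadControl
variable {n : ℕ} {N : LoadControl n}

theorem IsTrajectory.hasDerivAt_lyapunov {κ : ℝ} {z : ℝ → N.State} (hz : N.IsTrajectory κ z)
    (hf0 : ∀ i, Differentiable ℝ (N.f0 i)) (s : N.State) {t : ℝ} (ht : 0 < t) :
    HasDerivAt (fun τ => N.lyapunov κ s (z τ)) (N.lyapunovDeriv κ s (z t) (N.field κ (z t))) t :=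
  ((hz.hasDerivState ht.le).lyapunov hf0 κ s).hasDerivAt (Ici_mem_nhds ht)

theorem dissipation_rate_pos {κ : ℝ} (hκ0 : 0 < κ) (hκ1 : κ < 1) : 0 < 1 - (1 + κ) ^ 2 / 4 := by
  nlinarith

theorem State.normSq_nonneg (z : N.State) : 0 ≤ z.normSq := by
  rw [normSq_eq]; positivity

theorem State.distSq_nonneg (s z : N.State) : 0 ≤ s.distSq z := by
  rw [distSq_eq]; positivity

theorem IsTrajectory.antitoneOn_lyapunov {κ β : ℝ} {z : ℝ → N.State} (hz : N.IsTrajectory κ z)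
    (hκ0 : 0 < κ) (hκ1 : κ < 1) (hβ : 1 ≤ β)
    (hf0 : ∀ i, IsStronglyConvex β (N.f0 i)) (hf2 : ∀ i, ConvexOn ℝ Set.univ (N.f2 i))
    (hD : ∀ i, 0 ≤ N.D i) (hd : ∀ i, N.dLower i ≤ N.dUpper i) {s : N.State} (hs : N.KKT κ s) :
    AntitoneOn (fun τ => N.lyapunov κ s (z τ)) (Set.Ici 0) := by
  have hdiff := fun i => (hf0 i).1
  refine antitoneOn_of_deriv_nonpos (convex_Ici _)
    -- At time 0 the one-sided derivative supplies continuity, which is all that monotonicity on the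
    -- closed half-line needs there.
    (fun t ht => ((hz.hasDerivState ht).lyapunov hdiff κ s).continuousWithinAt)
    (fun t ht => ?_) fun t ht => ?_
  · rw [interior_Ici] at ht
    exact (hz.hasDerivAt_lyapunov hdiff s ht).differentiableAt.differentiableWithinAt
  · rw [interior_Ici] at ht
    rw [(hz.hasDerivAt_lyapunov hdiff s ht).deriv]
    have h1 := lyapunov_dissipation hβ hf0 hf2 hD hd hs (z t)
    have h2 := mul_nonneg (dissipation_rate_pos hκ0 hκ1).le (N.field κ (z t)).normSq_nonneg
    linarith

theorem IsTrajectory.frequently_speed_le {κ β : ℝ} {z : ℝ → N.State} (hz : N.IsTrajectory κ z)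
    (hκ0 : 0 < κ) (hκ1 : κ < 1) (hβ : 1 ≤ β)
    (hf0 : ∀ i, IsStronglyConvex β (N.f0 i)) (hf2 : ∀ i, ConvexOn ℝ Set.univ (N.f2 i))
    (hD : ∀ i, 0 ≤ N.D i) (hd : ∀ i, N.dLower i ≤ N.dUpper i) {s : N.State} (hs : N.KKT κ s) :
    ∃ᶠ t in atTop, N.speed z t ≤ 1 / Real.sqrt t := by
  have hc := dissipation_rate_pos hκ0 hκ1
  refine frequently_le_one_div_sqrt (V := fun τ => N.lyapunov κ s (z τ))
    -- The factor 8 is the Cauchy-Schwarz loss in passing from the sum of eight norms to the sum of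
    -- their squares.
    (a := (1 - (1 + κ) ^ 2 / 4) / 8) (by positivity)
    (fun t => (mul_nonneg (by positivity) (s.distSq_nonneg (z t))).trans
      (lyapunov_lower hκ0 hκ1 hβ hf0 hD hs (z t)))
    (fun t ht => hz.hasDerivAt_lyapunov (fun i => (hf0 i).1) s ht) fun t ht => ?_
  have h1 := lyapunov_dissipation hβ hf0 hf2 hD hd hs (z t)
  have h2 := mul_le_mul_of_nonneg_left (hz.speed_sq_le ht) hc.le
  linarith

theorem exists_tendstoState_of_distSq_le {s : N.State} {u : ℕ → N.State} {R : ℝ}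
    (h : ∀ k, s.distSq (u k) ≤ R ^ 2) (hR : 0 ≤ R) :
    ∃ (z : N.State) (φ : ℕ → ℕ), StrictMono φ ∧ TendstoState (fun k => u (φ k)) atTop z := by
  have hcomp : IsCompact (Metric.closedBall s.η R ×ˢ Metric.closedBall s.d R ×ˢ
      Metric.closedBall s.θ R ×ˢ Metric.closedBall s.P R ×ˢ Metric.closedBall s.ω R ×ˢ
      Metric.closedBall s.μ R ×ˢ Metric.closedBall s.νm R ×ˢ Metric.closedBall s.νp R) :=
    (isCompact_closedBall _ _).prod <| (isCompact_closedBall _ _).prod <|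
      (isCompact_closedBall _ _).prod <| (isCompact_closedBall _ _).prod <|
      (isCompact_closedBall _ _).prod <| (isCompact_closedBall _ _).prod <|
      (isCompact_closedBall _ _).prod (isCompact_closedBall _ _)
  have key : ∀ {E : Type} [NormedAddCommGroup E] (x x₀ : E) (k : ℕ),
      ‖x - x₀‖ ^ 2 ≤ s.distSq (u k) → x ∈ Metric.closedBall x₀ R := by
    intro E _ x x₀ k hx
    rw [mem_closedBall_iff_norm]
    exact (sq_le_sq₀ (norm_nonneg _) hR).1 (hx.trans (h k))
  obtain ⟨⟨a, b, c, d, e, f, g, i⟩, -, φ, hφ, hlim⟩ := hcomp.tendsto_subseq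
    (x := fun k => ((u k).η, (u k).d, (u k).θ, (u k).P, (u k).ω, (u k).μ, (u k).νm, (u k).νp))
    (fun k => by
      refine ⟨key _ _ k ?_, key _ _ k ?_, key _ _ k ?_, key _ _ k ?_, key _ _ k ?_, key _ _ k ?_,
        key _ _ k ?_, key _ _ k ?_⟩ <;>
      · rw [State.distSq_eq, ← sub_nonneg]
        ring_nf
        positivity)
  simp only [nhds_prod_eq, tendsto_prod_iff'] at hlim
  obtain ⟨h1, h2, h3, h4, h5, h6, h7, h8⟩ := hlim
  have coord : ∀ {ι : Type} [Fintype ι] {x : ℕ → EuclideanSpace ℝ ι} {x₀ : EuclideanSpace ℝ ι},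
      Tendsto x atTop (𝓝 x₀) → ∀ j, Tendsto (fun k => x k j) atTop (𝓝 (x₀ j)) :=
    fun hx j => ((EuclideanSpace.proj (𝕜 := ℝ) j).continuous.tendsto _).comp hx
  exact ⟨⟨a, b, c, d, e, f, g, i⟩, φ, hφ, coord h1, coord h2, coord h3, coord h4, coord h5,
    coord h6, coord h7, coord h8⟩

theorem IsTrajectory.exists_convergesTo {κ β : ℝ} {z : ℝ → N.State} (hz : N.IsTrajectory κ z)
    (hκ0 : 0 < κ) (hκ1 : κ < 1) (hβ : 1 ≤ β)
    (hf0 : ∀ i, IsStronglyConvex β (N.f0 i)) (hf2 : ∀ i, ConvexOn ℝ Set.univ (N.f2 i))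
    (hD : ∀ i, 0 ≤ N.D i) (hd : ∀ i, N.dLower i ≤ N.dUpper i) {s : N.State} (hs : N.KKT κ s) :
    ∃ zs : N.State, N.IsEquilibrium κ zs ∧ N.ConvergesTo z zs := by
  have hc := dissipation_rate_pos hκ0 hκ1
  have hcd := fun i => (hf0 i).continuous_deriv (by linarith)
  have hcf := fun i => (hf0 i).1.continuous
  -- times along which the speed tends to zero
  have hfreq : ∃ᶠ t in atTop, 0 < t ∧ (N.field κ (z t)).normSq ≤ t⁻¹ := by
    have := frequently_le_one_div_sqrt (V := fun τ => N.lyapunov κ s (z τ)) hc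
      (fun t => (mul_nonneg (by positivity) (s.distSq_nonneg (z t))).trans
        (lyapunov_lower hκ0 hκ1 hβ hf0 hD hs (z t)))
      (fun t ht => hz.hasDerivAt_lyapunov (fun i => (hf0 i).1) s ht)
      (q := fun t => Real.sqrt (N.field κ (z t)).normSq) fun t ht => by
        rw [Real.sq_sqrt (State.normSq_nonneg _)]
        exact lyapunov_dissipation hβ hf0 hf2 hD hd hs (z t)
    refine (this.and_eventually (eventually_gt_atTop 0)).mono fun t ⟨h1, h2⟩ => ⟨h2, ?_⟩
    have := pow_le_pow_left₀ (Real.sqrt_nonneg _) h1 2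
    rwa [Real.sq_sqrt (State.normSq_nonneg _), div_pow, Real.sq_sqrt h2.le, one_pow,
      one_div] at this
  obtain ⟨τ, hτ, hτs⟩ := exists_seq_forall_of_frequently hfreq
  have hbound : ∀ k, s.distSq (z (τ k)) ≤ Real.sqrt (8 / κ * N.lyapunov κ s (z 0)) ^ 2 := by
    intro k
    have h1 := lyapunov_lower hκ0 hκ1 hβ hf0 hD hs (z (τ k))
    have h2 := hz.antitoneOn_lyapunov hκ0 hκ1 hβ hf0 hf2 hD hd hs Set.self_mem_Ici
      (Set.mem_Ici.2 (hτs k).1.le) (hτs k).1.le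
    simp only at h2
    have h3 : s.distSq (z (τ k)) ≤ 8 / κ * N.lyapunov κ s (z 0) := by
      have := mul_le_mul_of_nonneg_left (h1.trans h2) (show 0 ≤ 8 / κ by positivity)
      calc s.distSq (z (τ k)) = 8 / κ * (κ / 8 * s.distSq (z (τ k))) := by field_simp
        _ ≤ _ := this
    rwa [Real.sq_sqrt ((s.distSq_nonneg _).trans h3)]
  obtain ⟨zs, φ, hφ, hlim⟩ := exists_tendstoState_of_distSq_le hbound (Real.sqrt_nonneg _)
  have hτφ : Tendsto (fun k => τ (φ k)) atTop atTop := hτ.comp hφ.tendsto_atTop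
  -- By continuity the field at the cluster point is the limit of the fields, which is zero.
  have heq : N.IsEquilibrium κ zs := by
    refine eq_zero_of_normSq_eq_zero (tendsto_nhds_unique
      (hlim.field hf2 hcd hd).normSq (squeeze_zero (fun k => State.normSq_nonneg _)
        (fun k => (hτs (φ k)).2) (tendsto_inv_atTop_zero.comp hτφ)))
  have hs' := N.isEquilibrium_iff.1 heq
  refine ⟨zs, heq, convergesTo_of_distSq ?_⟩
  -- The Lyapunov function is recentred at the cluster point itself; its decay along a subsequence
  -- extends to all times by monotonicity.
  have hV := tendsto_zero_of_antitoneOn (V := fun t => N.lyapunov κ zs (z t))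
    (fun t => (mul_nonneg (by positivity) (zs.distSq_nonneg (z t))).trans
        (lyapunov_lower hκ0 hκ1 hβ hf0 hD hs' (z t)))
    (hz.antitoneOn_lyapunov hκ0 hκ1 hβ hf0 hf2 hD hd hs') hτφ
    (by simpa only [hs'.lyapunov_self] using hlim.lyapunov hcf κ zs)
  have := squeeze_zero (fun t => mul_nonneg (by positivity) (zs.distSq_nonneg (z t)))
    (fun t => lyapunov_lower hκ0 hκ1 hβ hf0 hD hs' (z t)) hV
  have h2 := this.const_mul (8 / κ)
  rw [mul_zero] at h2
  refine h2.congr fun t => ?_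
  field_simp

/-! ### Sufficiency of the optimality conditions -/

theorem objective_eq_top {d ω : N.BusVec} {i : Fin n}
    (hi : ¬ (N.dLower i ≤ d i ∧ d i ≤ N.dUpper i)) : N.objective d ω = ⊤ := by
  -- In `EReal` the sum ⊤ + ⊥ is ⊥, so an infinite term forces the value ⊤ only if no other term is
  -- ⊥.
  have hbot : ∀ j, ((N.f0 j (d j) : ℝ) : EReal) + N.f1 j (d j) + ((N.f2 j (d j) : ℝ) : EReal)
      + ((N.D j / 2 * ω j ^ 2 : ℝ) : EReal) ≠ ⊥ := fun j => by
    rw [f1]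
    split_ifs
    · rw [add_zero, ← EReal.coe_add, ← EReal.coe_add]
      exact EReal.coe_ne_bot _
    · rw [EReal.coe_add_top, EReal.top_add_coe, EReal.top_add_coe]
      exact top_ne_bot
  rw [objective, ← Finset.add_sum_erase _ _ (Finset.mem_univ i), f1, if_neg hi]
  rw [EReal.coe_add_top, EReal.top_add_coe, EReal.top_add_coe]
  refine EReal.top_add_of_ne_bot ?_
  refine Finset.sum_induction _ (fun x : EReal => x ≠ ⊥) (fun a b ha hb => ?_) (by simp)
    fun j _ => hbot j
  rw [Ne, EReal.add_eq_bot_iff]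
  tauto

theorem objective_eq_coe {d ω : N.BusVec} (h : ∀ i, N.dLower i ≤ d i ∧ d i ≤ N.dUpper i) :
    N.objective d ω
      = ((∑ i, (N.f0 i (d i) + N.f2 i (d i) + N.D i / 2 * ω i ^ 2) : ℝ) : EReal) := by
  have hsum : ∀ (t : Finset (Fin n)) (g : Fin n → ℝ),
      ((∑ i ∈ t, g i : ℝ) : EReal) = ∑ i ∈ t, (g i : EReal) := fun t g =>
    map_sum (⟨⟨Real.toEReal, EReal.coe_zero⟩, EReal.coe_add⟩ : ℝ →+ EReal) g t
  rw [objective, hsum]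
  refine Finset.sum_congr rfl fun i _ => ?_
  rw [f1, if_pos (h i), add_zero, EReal.coe_add, EReal.coe_add]

theorem projNonneg_fixed {ν h : ℝ} (hh : projNonneg (ν + h) = ν) :
    0 ≤ ν ∧ h ≤ 0 ∧ ν * h = 0 := by
  rw [projNonneg] at hh
  rcases le_total (ν + h) 0 with h1 | h1
  · rw [max_eq_right h1] at hh
    subst hh
    exact ⟨le_rfl, by linarith, by ring⟩
  · rw [max_eq_left h1] at hh
    have : h = 0 := by linarith
    subst this
    exact ⟨by linarith, le_rfl, by ring⟩

theorem KKT.isOptimal {κ β : ℝ} (hβ : 0 ≤ β)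
    (hf0 : ∀ i, IsStronglyConvex β (N.f0 i)) (hf2 : ∀ i, ConvexOn ℝ Set.univ (N.f2 i))
    (hD : ∀ i, 0 ≤ N.D i) (hd : ∀ i, N.dLower i ≤ N.dUpper i) {s : N.State} (hs : N.KKT κ s) :
    N.IsOptimal s.d s.θ s.ω s.P := by
  have hm : ∀ e, _ := fun e => projNonneg_fixed (ν := s.νm e)
    (h := N.PLower e - N.lineFlow (fun j => s.θ j) e) (by rw [← add_sub_assoc]; exact hs.νm e)
  have hp : ∀ e, _ := fun e => projNonneg_fixed (ν := s.νp e)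
    (h := N.lineFlow (fun j => s.θ j) e - N.PUpper e) (by rw [← add_sub_assoc]; exact hs.νp e)
  have hmem : ∀ i, s.d i ∈ Set.Icc (N.dLower i) (N.dUpper i) := fun i => by
    rw [← hs.d i]; exact (N.prox_f1_variational (hd i) _).1
  refine ⟨⟨fun i => ?_, fun i => (hs.u2 i).symm, fun e => ⟨by linarith [(hm e).2.1],
    by linarith [(hp e).2.1]⟩⟩, fun d θ ω P ⟨hf1, hf2', hf3⟩ => ?_⟩
  · rw [← hs.u1 i, State.u1]; ring
  by_cases hΩ : ∀ i, N.dLower i ≤ d i ∧ d i ≤ N.dUpper i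
  swap
  · obtain ⟨i, hi⟩ := not_forall.1 hΩ
    rw [objective_eq_top (d := d) hi]
    exact le_top
  rw [objective_eq_coe hmem, objective_eq_coe hΩ, EReal.coe_le_coe_iff]
  have hbus : ∀ i, (s.ω i + s.μ i) * (d i - s.d i) + N.D i * s.ω i * (ω i - s.ω i)
      ≤ (N.f0 i (d i) + N.f2 i (d i) + N.D i / 2 * ω i ^ 2)
        - (N.f0 i (s.d i) + N.f2 i (s.d i) + N.D i / 2 * s.ω i ^ 2) := fun i => by
    have h1 := (hf0 i).2 (d i) (s.d i)
    have h2 := prox_coe_variational (hf2 i) (s.d i - κ * s.η i) (d i)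
    rw [hs.η i] at h2
    have h3 := (N.prox_f1_variational (hd i) (s.d i - deriv (N.f0 i) (s.d i) + κ * s.η i
      + s.ω i + s.μ i)).2 _ (hΩ i)
    rw [hs.d i] at h3
    have h4 := mul_nonneg (hD i) (sq_nonneg (ω i - s.ω i))
    have h5 := mul_nonneg hβ (sq_nonneg (d i - s.d i))
    linarith
  -- The competitor, completed by the multipliers of `s`, is a state with u₁ = u₂ = 0, so
  -- `KKT.u1_eq` and `KKT.u2_eq` apply to it.
  let z : N.State := ⟨s.η, d, θ, P, ω, s.μ, s.νm, s.νp⟩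
  have hz1 : ∀ i, z.u1 i = 0 := fun i => by
    have := hf1 i
    simp only [State.u1, z]; linarith
  have hz2 : ∀ i, z.u2 i = 0 := fun i => by
    have := hf2' i
    simp only [State.u2, z]; linarith
  have e1 := fun i => hs.u1_eq z i
  have e2 := fun i => hs.u2_eq z i
  simp only [hz1, hz2, z] at e1 e2
  have hω : ∑ i, s.ω i * N.netOut (fun e => P e - s.P e) i = 0 := by
    rw [sum_mul_netOut]
    exact Finset.sum_eq_zero fun e _ => by rw [hs.ω e, sub_self, zero_mul]
  -- Stationarity in the angles turns this into a pairing of line multipliers with flow deviations,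
  -- signed by complementary slackness and feasibility.
  have hμ : 0 ≤ -∑ i, s.μ i * N.netOut (N.lineFlow fun j => θ j - s.θ j) i := by
    rw [sum_mul_netOut_lineFlow_comm]
    have : ∀ i, N.netOut (N.lineFlow fun j => s.μ j) i
        = -N.netOut (fun e => N.B e * (s.νm e - s.νp e)) i := fun i => by linarith [hs.θ i]
    simp only [this, mul_neg, Finset.sum_neg_distrib, neg_neg]
    rw [sum_mul_netOut_mul]
    refine Finset.sum_nonneg fun e _ => ?_
    rw [lineFlow_sub]
    have a1 := mul_nonneg (hm e).1 (sub_nonneg.2 (hf3 e).1)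
    have a2 := mul_nonneg (hp e).1 (sub_nonneg.2 (hf3 e).2)
    have a3 := (hm e).2.2
    have a4 := (hp e).2.2
    linarith
  have hsum := Finset.sum_le_sum fun i (_ : i ∈ Finset.univ) => hbus i
  rw [Finset.sum_sub_distrib] at hsum
  have hlhs : ∑ i, ((s.ω i + s.μ i) * (d i - s.d i) + N.D i * s.ω i * (ω i - s.ω i))
      = -∑ i, s.ω i * N.netOut (fun e => P e - s.P e) i
        - ∑ i, s.μ i * N.netOut (N.lineFlow fun j => θ j - s.θ j) i := by
    rw [← Finset.sum_neg_distrib, ← Finset.sum_sub_distrib]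
    refine Finset.sum_congr rfl fun i _ => ?_
    rw [e1, e2]; ring
  linarith

end LoadControl

/-! ### Subgradients at a constrained minimizer -/

theorem sum_apply_update {ι : Type*} [Fintype ι] [DecidableEq ι] (g : ι → ℝ → ℝ) (x : ι → ℝ)
    (i : ι) (y : ℝ) :
    ∑ j, g j (Function.update x i y j) = ∑ j, g j (x j) + (g i y - g i (x i)) := by
  rw [← sub_eq_iff_eq_add', ← Finset.sum_sub_distrib, Finset.sum_eq_single i]
  · rw [Function.update_self]
  · intro j _ hj
    rw [Function.update_of_ne hj, sub_self]
  · simp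

/-- The open strict epigraph of F is separated from Q × (-∞, F(x₀)]. Normalising the vertical
component of the hyperplane gives p; separability lets one coordinate vary at a time, so each p_i is
a subgradient of f_i. -/
theorem exists_separable_subgradient {n : ℕ} {f : Fin n → ℝ → ℝ}
    (hf : ∀ i, ConvexOn ℝ Set.univ (f i)) {Q : Set (Fin n → ℝ)} (hQ : Convex ℝ Q)
    {x₀ : Fin n → ℝ} (hx₀ : x₀ ∈ Q) (hmin : ∀ x ∈ Q, ∑ i, f i (x₀ i) ≤ ∑ i, f i (x i)) :
    ∃ p : Fin n → ℝ, (∀ i y, f i (x₀ i) + p i * (y - x₀ i) ≤ f i y) ∧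
      ∀ x ∈ Q, 0 ≤ ∑ i, p i * (x i - x₀ i) := by
  set F : (Fin n → ℝ) → ℝ := fun x => ∑ i, f i (x i) with hF
  have hcont : Continuous F := continuous_finsetSum _ fun i _ =>
    (continuousOn_univ.1 ((hf i).continuousOn isOpen_univ)).comp (continuous_apply i)
  have hconv : ConvexOn ℝ Set.univ F := by
    refine ⟨convex_univ, fun x _ y _ a b ha hb hab => ?_⟩
    rw [Finset.smul_sum, Finset.smul_sum, ← Finset.sum_add_distrib]
    exact Finset.sum_le_sum fun i _ => (hf i).2 trivial trivial ha hb hab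
  obtain ⟨ℓ, u, h1, h2⟩ := geometric_hahn_banach_open
    (s := {q : (Fin n → ℝ) × ℝ | q.1 ∈ Set.univ ∧ F q.1 < q.2}) (t := Q ×ˢ Set.Iic (F x₀))
    hconv.convex_strict_epigraph
    (by simpa using isOpen_lt (hcont.comp continuous_fst) continuous_snd)
    (hQ.prod (convex_Iic _)) (Set.disjoint_left.2 fun q hq hq' =>
      absurd ((hmin _ hq'.1).trans_lt hq.2) (not_lt.2 hq'.2))
  set c := ℓ (0, 1) with hc
  have hℓ : ∀ x r, ℓ (x, r) = ℓ (x, 0) + r * c := fun x r => by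
    rw [hc, ← smul_eq_mul, ← map_smul, ← map_add]
    simp
  -- The functional is strictly below u one unit above (x₀, F(x₀)) and at least u at that point, so
  -- the hyperplane is not vertical.
  have hc0 : c < 0 := by
    have a1 := h1 (x₀, F x₀ + 1) ⟨trivial, lt_add_one _⟩
    have a2 := h2 (x₀, F x₀) ⟨hx₀, le_refl (F x₀)⟩
    rw [hℓ] at a1 a2
    linarith
  -- The graph is approached from the strict epigraph; raising the height by ε/(-c) changes the
  -- functional by -ε.
  have hle : ∀ x, ℓ (x, 0) + F x * c ≤ u := fun x => by
    refine le_of_forall_pos_le_add fun ε hε => ?_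
    have := h1 (x, F x + ε / (-c)) ⟨trivial, lt_add_of_pos_right _ (div_pos hε (by linarith))⟩
    rw [hℓ] at this
    have e : (F x + ε / -c) * c = F x * c - ε := by field_simp [hc0.ne]; ring
    linarith
  have hge : ∀ x ∈ Q, u ≤ ℓ (x, 0) + F x₀ * c := fun x hx => by
    have := h2 (x, F x₀) ⟨hx, le_refl (F x₀)⟩
    rwa [hℓ] at this
  have hsum : ∀ x : Fin n → ℝ, ℓ (x, 0) = ∑ i, ℓ (Pi.single i 1, 0) * x i := fun x => by
    have hx : x = ∑ i, x i • (Pi.single i 1 : Fin n → ℝ) := by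
      ext j
      simp [Finset.sum_apply, Pi.single_apply]
    set L : (Fin n → ℝ) →ₗ[ℝ] ℝ := ℓ.toLinearMap ∘ₗ LinearMap.inl ℝ _ _ with hL
    have hLx : ∀ y, ℓ (y, 0) = L y := fun y => rfl
    simp only [hLx]
    conv_lhs => rw [hx]
    rw [map_sum]
    refine Finset.sum_congr rfl fun i _ => ?_
    rw [map_smul, smul_eq_mul, mul_comm]
  refine ⟨fun i => ℓ (Pi.single i 1, 0) / (-c), fun i y => ?_, fun x hx => ?_⟩
  · have a1 := (hle (Function.update x₀ i y)).trans (hge x₀ hx₀)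
    have e1 : F (Function.update x₀ i y) = F x₀ + (f i y - f i (x₀ i)) := by
      simp only [hF, sum_apply_update f]
    have e2 : ℓ (Function.update x₀ i y, 0)
        = ℓ (x₀, 0) + ℓ (Pi.single i 1, 0) * (y - x₀ i) := by
      rw [hsum, hsum x₀, sum_apply_update fun j r => ℓ (Pi.single j 1, 0) * r]
      ring
    rw [e1, e2] at a1
    have : ℓ (Pi.single i 1, 0) * (y - x₀ i) ≤ (f i y - f i (x₀ i)) * (-c) := by linarith
    rw [← div_le_iff₀ (by linarith)] at this
    rw [div_mul_eq_mul_div]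
    linarith
  · have a1 := (hle x₀).trans (hge x hx)
    rw [hsum, hsum x] at a1
    have : ∑ i, ℓ (Pi.single i 1, 0) / (-c) * (x i - x₀ i)
        = (∑ i, ℓ (Pi.single i 1, 0) * x i - ∑ i, ℓ (Pi.single i 1, 0) * x₀ i) / (-c) := by
      rw [← Finset.sum_sub_distrib, Finset.sum_div]
      exact Finset.sum_congr rfl fun i _ => by ring
    rw [this]
    exact div_nonneg (by linarith) (by linarith)

/-- Along the segment from x to y, convexity bounds the increment of g by t(g(y) - g(x)), so the
difference quotients of f are at least p(y - x) - (g(y) - g(x)); then t → 0⁺. -/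
theorem subgradient_sub_deriv {f g : ℝ → ℝ} {x p : ℝ} (hf : DifferentiableAt ℝ f x)
    (hg : ConvexOn ℝ Set.univ g) (h : ∀ y, f x + g x + p * (y - x) ≤ f y + g y) (y : ℝ) :
    g x + (p - deriv f x) * (y - x) ≤ g y := by
  have hd : HasDerivAt (fun t : ℝ => f (x + t * (y - x))) (deriv f x * (y - x)) 0 := by
    have h1 : HasDerivAt (fun t : ℝ => x + t * (y - x)) (y - x) 0 := by
      simpa using ((hasDerivAt_id (0 : ℝ)).mul_const (y - x)).const_add x
    have h2 : HasDerivAt f (deriv f x) (x + 0 * (y - x)) := by simpa using hf.hasDerivAt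
    exact h2.comp (0 : ℝ) h1
  have hlim := hd.tendsto_slope_zero_right
  have : p * (y - x) - (g y - g x) ≤ deriv f x * (y - x) := by
    refine ge_of_tendsto hlim ?_
    filter_upwards [Ioc_mem_nhdsGT (zero_lt_one (α := ℝ))] with t ht
    have h1 := h (x + t * (y - x))
    have h2 := hg.2 (Set.mem_univ x) (Set.mem_univ y) (sub_nonneg.2 ht.2) ht.1.le (by ring)
    simp only [smul_eq_mul] at h2
    rw [show (1 - t) * x + t * y = x + t * (y - x) by ring] at h2
    simp only [zero_add, zero_mul, add_zero, smul_eq_mul]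
    rw [inv_mul_eq_div, le_div_iff₀ ht.1]
    linarith
  linarith

theorem eventually_le_add_mul {a b c : ℝ} (hab : a ≤ b) (h : a = b → 0 ≤ c) :
    ∀ᶠ t in 𝓝[>] (0 : ℝ), a ≤ b + t * c := by
  rcases hab.eq_or_lt with rfl | hlt
  · filter_upwards [self_mem_nhdsWithin] with t ht
    exact le_add_of_nonneg_right (mul_nonneg (le_of_lt ht) (h rfl))
  · have hc : Tendsto (fun t : ℝ => b + t * c) (𝓝[>] 0) (𝓝 (b + 0 * c)) :=
      ((by fun_prop : Continuous fun t : ℝ => b + t * c).tendsto 0).mono_left nhdsWithin_le_nhds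
    exact (hc.eventually (lt_mem_nhds (by simpa using hlt))).mono fun t => le_of_lt

/-! ### Existence of an equilibrium -/

namespace LoadControl
variable {n : ℕ} (N : LoadControl n)

/-- Line flow as a linear functional of the phase angles. -/
def lineFlowₗ (e : N.edges) : (Fin n → ℝ) →ₗ[ℝ] ℝ where
  toFun θ := N.lineFlow θ e
  map_add' x y := N.lineFlow_add x y e
  map_smul' c x := N.lineFlow_smul c x e

/-- Change of the load at a bus that balances a change of the phase angles. -/
def loadChange (i : Fin n) : (Fin n → ℝ) →ₗ[ℝ] ℝ where
  toFun θ := -N.netOut (N.lineFlow θ) i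
  map_add' x y := by
    have : N.lineFlow (x + y) = fun e => N.lineFlow x e + N.lineFlow y e :=
      funext fun e => N.lineFlow_add x y e
    rw [this, netOut_add]; ring
  map_smul' c x := by
    have : N.lineFlow (c • x) = fun e => c * N.lineFlow x e :=
      funext fun e => N.lineFlow_smul c x e
    rw [this, netOut_smul, RingHom.id_apply, smul_eq_mul]; ring

/-- Loads and phase angles satisfying the power balance, the load limits and the thermal limits. -/
structure Admissible (d θ : Fin n → ℝ) : Prop where
  balance : ∀ i, d i = N.Pin i - N.netOut (N.lineFlow θ) i
  load : ∀ i, N.dLower i ≤ d i ∧ d i ≤ N.dUpper i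
  line : ∀ e, N.PLower e ≤ N.lineFlow θ e ∧ N.lineFlow θ e ≤ N.PUpper e

theorem exists_admissible_isMin (hS : N.Slater) {f : Fin n → ℝ → ℝ} (hf : ∀ i, Continuous (f i)) :
    ∃ d θ, N.Admissible d θ ∧
      ∀ d' θ', N.Admissible d' θ' → ∑ i, f i (d i) ≤ ∑ i, f i (d' i) := by
  -- Admissible angles are unbounded, being invariant under a common shift. Flows are used instead:
  -- they are bounded by the line limits and range over a closed subspace.
  set G : Submodule ℝ (N.edges → ℝ) := LinearMap.range (LinearMap.pi N.lineFlowₗ)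
  have hG : ∀ θ, N.lineFlow θ ∈ G := fun θ => ⟨θ, rfl⟩
  set K : Set ((Fin n → ℝ) × (N.edges → ℝ)) := (Set.Icc N.dLower N.dUpper ×ˢ
    Set.Icc N.PLower N.PUpper) ∩ ({x | x.2 ∈ G} ∩ {x | ∀ i, x.1 i = N.Pin i - N.netOut x.2 i})
  have hK : IsCompact K := by
    refine (isCompact_Icc.prod isCompact_Icc).inter_right (IsClosed.inter ?_ ?_)
    · exact (Submodule.closed_of_finiteDimensional G).preimage continuous_snd
    · rw [Set.ofPred_forall]
      refine isClosed_iInter fun i => isClosed_eq (by fun_prop) (continuous_const.sub ?_)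
      exact continuous_iff_continuousAt.2 fun x => tendsto_netOut
        (fun e => ((continuous_apply e).comp continuous_snd).tendsto x) i
  have hmem : ∀ d θ, N.Admissible d θ → (d, N.lineFlow θ) ∈ K := fun d θ h =>
    ⟨⟨⟨fun i => (h.load i).1, fun i => (h.load i).2⟩, ⟨fun e => (h.line e).1,
      fun e => (h.line e).2⟩⟩, hG θ, h.balance⟩
  have hne : K.Nonempty := by
    obtain ⟨d, hd, θ, hb, hl⟩ := hS
    refine ⟨_, hmem (fun i => d i) (fun i => θ i) ⟨fun i => ?_, intrinsicInterior_subset hd,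
      fun e => ⟨(hl e).1.le, (hl e).2.le⟩⟩⟩
    rw [netOut]; linarith [hb i]
  obtain ⟨⟨d, g⟩, ⟨⟨h1, h2⟩, ⟨θ, hθ⟩, h3⟩, hmin⟩ := hK.exists_isMinOn hne
    (f := fun x => ∑ i, f i (x.1 i)) (continuous_finsetSum _ fun i _ =>
      (hf i).comp ((continuous_apply i).comp continuous_fst)).continuousOn
  have hg : g = N.lineFlow θ := hθ.symm
  subst hg
  exact ⟨d, θ, ⟨h3, fun i => ⟨h1.1 i, h1.2 i⟩, fun e => ⟨h2.1 e, h2.2 e⟩⟩,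
    fun d' θ' h => hmin (hmem d' θ' h)⟩

/-- A direction compatible with the active constraints stays admissible for a short step, so p is
nonnegative on it. `farkas` then writes p as a nonnegative combination of the active constraints;
since these are affine, no interior point is needed. -/
theorem exists_multipliers {d θ p : Fin n → ℝ} (h : N.Admissible d θ)
    (hp : ∀ d' θ', N.Admissible d' θ' → 0 ≤ ∑ i, p i * (d' i - d i)) :
    ∃ (a b : Fin n → ℝ) (νm νp : N.edges → ℝ),
      (∀ i, 0 ≤ a i ∧ (d i ≠ N.dLower i → a i = 0)) ∧
      (∀ i, 0 ≤ b i ∧ (d i ≠ N.dUpper i → b i = 0)) ∧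
      (∀ e, 0 ≤ νm e ∧ (N.lineFlow θ e ≠ N.PLower e → νm e = 0)) ∧
      (∀ e, 0 ≤ νp e ∧ (N.lineFlow θ e ≠ N.PUpper e → νp e = 0)) ∧
      ∀ i, N.netOut (fun e => N.B e * (νm e - νp e)) i
        + N.netOut (N.lineFlow fun j => p j - a j + b j) i = 0 := by
  classical
  let A : (Fin n ⊕ Fin n) ⊕ (N.edges ⊕ N.edges) → (Fin n → ℝ) →ₗ[ℝ] ℝ :=
    Sum.elim (Sum.elim N.loadChange fun i => -N.loadChange i)
      (Sum.elim N.lineFlowₗ fun e => -N.lineFlowₗ e)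
  let active : (Fin n ⊕ Fin n) ⊕ (N.edges ⊕ N.edges) → Prop :=
    Sum.elim (Sum.elim (fun i => d i = N.dLower i) fun i => d i = N.dUpper i)
      (Sum.elim (fun e => N.lineFlow θ e = N.PLower e) fun e => N.lineFlow θ e = N.PUpper e)
  obtain ⟨c, hc, hpc⟩ := farkas (Finset.univ.filter active) A (∑ i, p i • N.loadChange i)
    fun φ hφ => by
      have hφ' : ∀ k, active k → 0 ≤ A k φ := fun k hk => hφ k (by simpa using hk)
      have hev : ∀ᶠ t in 𝓝[>] (0 : ℝ),
          (∀ i, N.dLower i ≤ d i + t * N.loadChange i φ) ∧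
          (∀ i, -N.dUpper i ≤ -d i + t * -N.loadChange i φ) ∧
          (∀ e, N.PLower e ≤ N.lineFlow θ e + t * N.lineFlowₗ e φ) ∧
          (∀ e, -N.PUpper e ≤ -N.lineFlow θ e + t * -N.lineFlowₗ e φ) := by
        refine (eventually_all.2 fun i => ?_).and <| (eventually_all.2 fun i => ?_).and <|
          (eventually_all.2 fun e => ?_).and <| eventually_all.2 fun e => ?_
        · exact eventually_le_add_mul (h.load i).1 fun hi => hφ' (Sum.inl (Sum.inl i)) hi.symm
        · exact eventually_le_add_mul (neg_le_neg (h.load i).2) fun hi =>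
            hφ' (Sum.inl (Sum.inr i)) (neg_injective hi).symm
        · exact eventually_le_add_mul (h.line e).1 fun he => hφ' (Sum.inr (Sum.inl e)) he.symm
        · exact eventually_le_add_mul (neg_le_neg (h.line e).2) fun he =>
            hφ' (Sum.inr (Sum.inr e)) (neg_injective he).symm
      obtain ⟨t, ⟨h1, h2, h3, h4⟩, ht⟩ := (hev.and self_mem_nhdsWithin).exists
      have hflow : ∀ e, N.lineFlow (θ + t • φ) e = N.lineFlow θ e + t * N.lineFlowₗ e φ :=
        fun e => by
          change N.lineFlowₗ e (θ + t • φ) = N.lineFlowₗ e θ + _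
          rw [map_add, map_smul, smul_eq_mul]
      have hload : ∀ i, -N.netOut (N.lineFlow (θ + t • φ)) i
          = -N.netOut (N.lineFlow θ) i + t * N.loadChange i φ := fun i => by
        change N.loadChange i (θ + t • φ) = N.loadChange i θ + _
        rw [map_add, map_smul, smul_eq_mul]
      have key := hp (fun i => d i + t * N.loadChange i φ) (θ + t • φ)
        ⟨fun i => by linarith [h.balance i, hload i], fun i => ⟨h1 i, by linarith [h2 i]⟩,
          fun e => ⟨by rw [hflow]; exact h3 e, by rw [hflow]; linarith [h4 e]⟩⟩
      have e1 : ∑ i, p i * (d i + t * N.loadChange i φ - d i)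
          = t * (∑ i, p i • N.loadChange i) φ := by
        rw [LinearMap.sum_apply, Finset.mul_sum]
        refine Finset.sum_congr rfl fun i _ => ?_
        rw [LinearMap.smul_apply, smul_eq_mul]; ring
      rw [e1] at key
      exact nonneg_of_mul_nonneg_right key ht
  have hite : ∀ (q : Prop) [Decidable q] (k), 0 ≤ (if q then c k else 0) ∧
      (¬ q → (if q then c k else 0) = 0) := fun q _ k =>
    ⟨by split_ifs; exacts [hc k, le_rfl], fun hq => if_neg hq⟩
  set a : Fin n → ℝ := fun i => if d i = N.dLower i then c (Sum.inl (Sum.inl i)) else 0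
  set b : Fin n → ℝ := fun i => if d i = N.dUpper i then c (Sum.inl (Sum.inr i)) else 0
  set νm : N.edges → ℝ := fun e =>
    if N.lineFlow θ e = N.PLower e then c (Sum.inr (Sum.inl e)) else 0
  set νp : N.edges → ℝ := fun e =>
    if N.lineFlow θ e = N.PUpper e then c (Sum.inr (Sum.inr e)) else 0
  refine ⟨a, b, νm, νp, fun i => hite _ _, fun i => hite _ _, fun e => hite _ _,
    fun e => hite _ _, fun i => ?_⟩
  have hall : ∀ φ : Fin n → ℝ, ∑ j, p j * -N.netOut (N.lineFlow φ) j
      = (∑ j, a j * -N.netOut (N.lineFlow φ) j + ∑ j, b j * -(-N.netOut (N.lineFlow φ) j))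
        + (∑ e, νm e * N.lineFlow φ e + ∑ e, νp e * -N.lineFlow φ e) := fun φ => by
    have hi := LinearMap.congr_fun hpc φ
    have hk : (∑ k ∈ Finset.univ.filter active, c k • A k) φ
        = ∑ k, (if active k then c k else 0) * A k φ := by
      rw [LinearMap.sum_apply, Finset.sum_filter]
      refine Finset.sum_congr rfl fun k _ => ?_
      split_ifs <;> simp
    rw [hk, Fintype.sum_sum_type, Fintype.sum_sum_type, Fintype.sum_sum_type,
      LinearMap.sum_apply] at hi
    exact hi
  -- Testing the identity of functionals on the unit vector at bus i gives stationarity in the angle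
  -- at i.
  have h1 := hall (Pi.single i 1)
  have h2 := N.sum_mul_netOut_lineFlow_comm (fun j => p j - a j + b j) (Pi.single i 1)
  have h3 := N.sum_mul_netOut_mul (Pi.single i 1) fun e => νm e - νp e
  simp only [Pi.single_apply, ite_mul, one_mul, zero_mul, Finset.sum_ite_eq', Finset.mem_univ,
    if_true] at h2 h3
  rw [← h2, h3]
  simp only [mul_neg, neg_neg, Finset.sum_neg_distrib] at h1
  simp only [mul_sub, add_mul, sub_mul, Finset.sum_sub_distrib, Finset.sum_add_distrib]
  simp only [mul_comm (N.lineFlow _ _)] at h1 ⊢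
  linarith

theorem exists_kkt {κ β : ℝ} (hκ0 : κ ≠ 0) (hβ : 0 ≤ β)
    (hf0 : ∀ i, IsStronglyConvex β (N.f0 i)) (hf2 : ∀ i, ConvexOn ℝ Set.univ (N.f2 i))
    (hS : N.Slater) : ∃ s : N.State, N.KKT κ s := by
  have hc2 : ∀ i, Continuous (N.f2 i) := fun i =>
    continuousOn_univ.1 ((hf2 i).continuousOn isOpen_univ)
  have hc0 : ∀ i, ConvexOn ℝ Set.univ (N.f0 i) := fun i => by
    refine ⟨convex_univ, fun x _ y _ a b ha hb hab => ?_⟩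
    simp only [smul_eq_mul]
    set w := a * x + b * y
    have h1 := (hf0 i).2 x w
    have h2 := (hf0 i).2 y w
    have h3 := mul_nonneg hβ (sq_nonneg (x - w))
    have h4 := mul_nonneg hβ (sq_nonneg (y - w))
    have h5 : N.f0 i w + deriv (N.f0 i) w * (x - w) ≤ N.f0 i x := by linarith
    have h6 : N.f0 i w + deriv (N.f0 i) w * (y - w) ≤ N.f0 i y := by linarith
    have h7 := add_le_add (mul_le_mul_of_nonneg_left h5 ha) (mul_le_mul_of_nonneg_left h6 hb)
    have h8 : a * (N.f0 i w + deriv (N.f0 i) w * (x - w))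
        + b * (N.f0 i w + deriv (N.f0 i) w * (y - w)) = N.f0 i w := by
      have : b = 1 - a := by linarith
      simp only [w, this]
      ring
    linarith
  obtain ⟨d, θ, hadm, hmin⟩ := N.exists_admissible_isMin hS
    (f := fun i x => N.f0 i x + N.f2 i x) fun i => (hf0 i).1.continuous.add (hc2 i)
  have hQ : Convex ℝ {d | ∃ θ, N.Admissible d θ} := by
    rintro d₁ ⟨θ₁, h₁⟩ d₂ ⟨θ₂, h₂⟩ a b ha hb hab
    have hflow : ∀ e, N.lineFlow (a • θ₁ + b • θ₂) e
        = a * N.lineFlow θ₁ e + b * N.lineFlow θ₂ e := fun e => by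
      change N.lineFlowₗ e (a • θ₁ + b • θ₂) = a * N.lineFlowₗ e θ₁ + b * N.lineFlowₗ e θ₂
      rw [map_add, map_smul, map_smul, smul_eq_mul, smul_eq_mul]
    refine ⟨a • θ₁ + b • θ₂, fun i => ?_, fun i => ?_, fun e => ?_⟩
    · rw [funext hflow, netOut_add, netOut_smul, netOut_smul]
      simp only [Pi.add_apply, Pi.smul_apply, smul_eq_mul, h₁.balance, h₂.balance]
      have : b = 1 - a := by linarith
      rw [this]; ring
    · exact convex_Icc (N.dLower i) (N.dUpper i) (h₁.load i) (h₂.load i) ha hb hab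
    · rw [hflow]
      exact convex_Icc (N.PLower e) (N.PUpper e) (h₁.line e) (h₂.line e) ha hb hab
  obtain ⟨p, hp, hpQ⟩ := exists_separable_subgradient
    (f := fun i x => N.f0 i x + N.f2 i x) (fun i => (hc0 i).add (hf2 i)) hQ ⟨θ, hadm⟩
    fun d' ⟨θ', h'⟩ => hmin d' θ' h'
  obtain ⟨a, b, νm, νp, ha, hb, hm, hpl, hθ⟩ :=
    N.exists_multipliers hadm fun d' θ' h' => hpQ d' ⟨θ', h'⟩
  -- With ω = 0 and P the flow of θ, both balances reduce to admissibility. The choice of η makes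
  -- -κη = p - f₀'(d), a subgradient of f₂ at d, and with μ = p - a + b the argument of the second
  -- proximal map becomes d - a + b.
  refine ⟨⟨WithLp.toLp 2 fun i => -(p i - deriv (N.f0 i) (d i)) / κ, WithLp.toLp 2 d,
    WithLp.toLp 2 θ, WithLp.toLp 2 (N.lineFlow θ), 0, WithLp.toLp 2 fun j => p j - a j + b j,
    WithLp.toLp 2 νm, WithLp.toLp 2 νp⟩, fun i => ?_, fun i => ?_, fun e => rfl, fun e => ?_,
    fun e => ?_, hθ, fun i => ?_, fun i => ?_⟩
  · rw [State.u1_eq]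
    simp only [PiLp.zero_apply]
    linarith [hadm.balance i]
  · rw [State.u2_eq]
    simp only
    linarith [hadm.balance i]
  · simp only [State.projνm, projNonneg]
    by_cases he : N.lineFlow θ e = N.PLower e
    · rw [he, add_sub_cancel_right, max_eq_left (hm e).1]
    · rw [(hm e).2 he, zero_add, max_eq_right]
      linarith [(hadm.line e).1]
  · simp only [State.projνp, projNonneg]
    by_cases he : N.lineFlow θ e = N.PUpper e
    · rw [he, add_sub_cancel_right, max_eq_left (hpl e).1]
    · rw [(hpl e).2 he, zero_add, max_eq_right]
      linarith [(hadm.line e).2]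
  · refine prox_coe_eq_of_subgradient (hf2 i) fun x => ?_
    have h1 := subgradient_sub_deriv ((hf0 i).1 (d i)) (hf2 i) (hp i) x
    simp only
    rw [mul_div_cancel₀ _ hκ0]
    linarith
  · refine N.prox_f1_eq (hadm.load i) fun x hx => ?_
    simp only [PiLp.zero_apply]
    rw [mul_div_cancel₀ _ hκ0]
    have h1 : 0 ≤ a i * (x - d i) := by
      by_cases hi : d i = N.dLower i
      · exact mul_nonneg (ha i).1 (by linarith [hx.1])
      · rw [(ha i).2 hi, zero_mul]
    have h2 : b i * (x - d i) ≤ 0 := by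
      by_cases hi : d i = N.dUpper i
      · exact mul_nonpos_of_nonneg_of_nonpos (hb i).1 (by linarith [hx.2])
      · rw [(hb i).2 hi, zero_mul]
    linarith

end LoadControl

theorem mainTheorem2 {n : ℕ} (N : LoadControl n) (κ β : ℝ)
    (hnet : N.IsConnectedNetwork) (hD : ∀ i, 0 < N.D i)
    (hf2 : ∀ i, ConvexOn ℝ Set.univ (N.f2 i))
    (hβ : 1 < β) (hf0 : ∀ i, IsStronglyConvex β (N.f0 i))
    (hSlater : N.Slater) (hκ0 : 0 < κ) (hκ1 : κ < 1)
    (z : ℝ → N.State) (hz : N.IsTrajectory κ z) :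
    (∃ zs : N.State, N.IsEquilibrium κ zs ∧ N.IsOptimal zs.d zs.θ zs.ω zs.P ∧
      N.ConvergesTo z zs) ∧
    ∃ c : ℝ, 0 < c ∧ ∃ᶠ t in atTop, N.speed z t ≤ c / Real.sqrt t := by
  have hd := N.dLower_le_dUpper hSlater
  have hD' := fun i => (hD i).le
  have hβ0 : 0 ≤ β := by linarith
  obtain ⟨s, hs⟩ := N.exists_kkt hκ0.ne' hβ0 hf0 hf2 hSlater
  refine ⟨?_, 1, one_pos, hz.frequently_speed_le hκ0 hκ1 hβ.le hf0 hf2 hD' hd hs⟩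
  obtain ⟨zs, heq, hconv⟩ := hz.exists_convergesTo hκ0 hκ1 hβ.le hf0 hf2 hD' hd hs
  exact ⟨zs, heq, (N.isEquilibrium_iff.1 heq).isOptimal hβ0 hf0 hf2 hD' hd, hconv⟩
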